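/- **Problem and noise.** Let $f:\mathbb R^n\to\mathbb R$, $c:\mathbb R^n\to\mathbb R^m$, with noisy estimates $\bar f,\bar g,\bar c,\bar J$ of $f,\nabla f,c$ and of the Jacobian $J=\nabla c^T$ (functions of $x$). A subscript $k$ denotes evaluation at $x_k$; norms are 2-norms. Let $\mathcal X\subseteq\mathbb R^n$ be open and convex. On $\mathcal X$: $f,c$ are differentiable, $f\ge f_{\inf}$, $\|\nabla f\|\le\kappa_g$, $\|c\|\le\kappa_c$, $\|J\|\le\kappa_J$, $\nabla f$ is $L$-Lipschitz, $J$ is $\Gamma$-Lipschitz, and $|\bar f-f|\le\epsilon_f$, $\|\bar g-\nabla f\|\le\epsilon_g$, $\|\bar c-c\|\le\epsilon_c$, $\|\bar J-J\|\le\epsilon_J$. Here $\kappa_g,\kappa_c,\kappa_J,L>0$, $\Gamma\ge0$ and the noise levels are $\ge0$. **Parameters.** $\epsilon_o\in[0,\epsilon_c]$; $\kappa_H,\zeta,\kappa_\sigma,\sigma_{Jc},\kappa_{\rho r},\lambda_{uv},\lambda_v,\bar\tau_{-1}>0$; $\bar\gamma_c,\gamma_c\in(0,1]$; $\lambda_{\rho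 r},\sigma_u,\sigma_c,\sigma_\tau,\eta\in(0,1)$; $\lambda_u\in(0,\zeta)$; $\sigma_r\in(\sigma_c,1)$. Adaptive rule ($i=A$): $\Gamma,\sigma_\chi,\theta,\bar\chi_{-1},\bar\zeta_{-1},\bar\xi_{-1}>0$, $\sigma_\zeta,\sigma_\xi\in(0,1)$, $\beta\in(0,1]$, $\frac{2(1-\eta)\beta\bar\xi_{-1}\bar\tau_{-1}}{\bar\tau_{-1}L+\Gamma}\le1$, $\frac{2(1-\eta)\beta\bar\xi_{-1}}{\Gamma}\le1$. Line search ($i=L$): $\alpha_u^L\in(0,1]$, $\nu\in(0,1)$. **Normal steps.** For $\sigma>0$, $\gamma\in(0,1]$, call $v$ a $(\sigma,\gamma)$-normal step for $(J,c)$ if $v\in\mathrm{Range}(J^T)$, $\|v\|\le\sigma\|J^Tc\|$ and $\|c\|-\|c+Jv\|\ge\gamma(\|c\|-\|c-\alpha JJ^Tc\|)$ with $\alpha=\min\{\sigma,\|J^Tc\|^2/\|JJ^Tc\|^2\}$. **Method.** Put $\Delta\bar l(x,\tau,d)=-\tau\bar g(x)^Td+\|\bar c(x)\|-\|\bar c(x)+\bar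 J(x)d\|$. Iteration $k\ge0$ has a matrix $H_k$, a normal step $\bar v_k$, a tangential step $\bar u_k$ with multiplier $\bar y_k$, $\bar d_k=\bar v_k+\bar u_k$, residuals $\bar\rho_k=H_k\bar u_k+\bar J_k^T\bar y_k+\bar g_k+H_k\bar v_k$ and $\bar r_k=\bar J_k\bar u_k$; let $M_k=\max\{\bar u_k^TH_k\bar u_k,\lambda_u\|\bar u_k\|^2\}$. Always $$\max\{\|\bar\rho_k\|,\|\bar r_k\|\}\le\lambda_{\rho r}\min\{\max\{\|\bar u_k\|,\|\bar J_k^T\bar c_k\|\},\kappa_{\rho r}\}.$$ * If $\|\bar c_k\|\le\epsilon_o$: $\bar v_k=0$, $\bar\tau_k=\bar\tau_{k-1}$, $\bar u_k^TH_k\bar u_k\ge\lambda_u\|\bar u_k\|^2-\epsilon_o$, $\bar g_k^T\bar u_k+\frac12\bar u_k^TH_k\bar u_k\le\epsilon_o$, $\Delta\bar l(x_k,\bar\tau_{k-1},\bar u_k)\ge\bar\tau_{k-1}\sigma_uM_k-\epsilon_o$; and the method stops if $\Delta\bar l(x_k,\bar\tau_k,\bar d_k)\le\epsilon_o$. * If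 $\|\bar c_k\|>\epsilon_o$: the method stops if $\bar J_k^T\bar c_k=0$; $\bar v_k$ is a $(\sigma_{Jc},\bar\gamma_c)$-normal step for $(\bar J_k,\bar c_k)$; either $\|\bar u_k\|\le\lambda_{uv}\|\bar v_k\|$, or both $\bar u_k^TH_k\bar u_k\ge\lambda_u\|\bar u_k\|^2$ and $(\bar g_k+H_k\bar v_k)^T\bar u_k+\max\{\frac12,1-\|\bar J_k^T\bar c_k\|\}\bar u_k^TH_k\bar u_k\le\lambda_v\|\bar v_k\|$; and at least one of (a) $\Delta\bar l(x_k,\bar\tau_{k-1},\bar d_k)\ge\bar\tau_{k-1}\sigma_uM_k+\sigma_c(\|\bar c_k\|-\|\bar c_k+\bar J_k\bar v_k\|)$, (b) $\|\bar c_k\|-\|\bar c_k+\bar J_k\bar v_k+\bar r_k\|\ge\sigma_r(\|\bar c_k\|-\|\bar c_k+\bar J_k\bar v_k\|)>0$ holds. If (a) holds, $\bar\tau_k=\bar\tau_{k-1}$. Otherwise let $\bar\tau_k^{trial}=\infty$ if $\bar g_k^T\bar d_k+M_k\le0$ and $\bar\tau_k^{trial}=\frac{(1-\sigma_c/\sigma_r)(\|\bar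 c_k\|-\|\bar c_k+\bar J_k\bar v_k+\bar r_k\|)}{\bar g_k^T\bar d_k+M_k}$ if not; $\bar\tau_k=\bar\tau_{k-1}$ if $\bar\tau_{k-1}\le(1-\sigma_\tau)\bar\tau_k^{trial}$, else $\bar\tau_k=(1-\sigma_\tau)\bar\tau_k^{trial}$. Then $x_{k+1}=x_k+\bar\alpha_k\bar d_k$. Write $\Delta_k=\Delta\bar l(x_k,\bar\tau_k,\bar d_k)$. *Adaptive rule.* $(\bar\chi_k,\bar\zeta_k)=((1+\sigma_\chi)\bar\chi_{k-1},(1-\sigma_\zeta)\bar\zeta_{k-1})$ if $\|\bar u_k\|^2\ge\bar\chi_{k-1}\|\bar v_k\|^2$ and $\frac12\bar d_k^TH_k\bar d_k<\frac14\bar\zeta_{k-1}\|\bar u_k\|^2$, else unchanged. Let $t_k=\bar\tau_k$ if $\|\bar u_k\|^2\ge\bar\chi_k\|\bar v_k\|^2$ and $t_k=1$ otherwise; $\bar\xi_k^{trial}=\Delta_k/(t_k\|\bar d_k\|^2)$; $\bar\xi_k=\bar\xi_{k-1}$ if $\bar\xi_{k-1}\le\bar\xi_k^{trial}$, else $\min\{(1-\sigma_\xi)\bar\xi_{k-1},\bar\xi_k^{trial}\}$.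 $\bar\alpha_k$ is the projection of $\min\{\frac{2(1-\eta)\beta\Delta_k}{(\bar\tau_kL+\Gamma)\|\bar d_k\|^2},1\}$ onto $[\bar\alpha_k^{\min},\bar\alpha_k^{\min}+\theta\beta]$, $\bar\alpha_k^{\min}=\frac{2(1-\eta)\beta\bar\xi_kt_k}{\bar\tau_kL+\Gamma}$. *Line search.* $\bar\alpha_k$ is the first of $\alpha_u^L,\nu\alpha_u^L,\nu^2\alpha_u^L,\dots$ with $\bar\phi(x_k+\bar\alpha_k\bar d_k,\bar\tau_k)\le\bar\phi(x_k,\bar\tau_k)-\eta\bar\alpha_k\Delta_k+\epsilon_{A_k}$, where $\bar\phi(x,\tau)=\tau\bar f(x)+\|\bar c(x)\|$, $\epsilon_{A_k}=2\bar\tau_k\epsilon_f+4\epsilon_c+\bar\tau_k\alpha_u^L\epsilon_g\|\bar d_k\|+\alpha_u^L\epsilon_J\|\bar d_k\|$. **Assumptions on the run.** The method never stops; $x_k,x_k+\bar d_k\in\mathcal X$; $\|H_k\|\le\kappa_H$ and $u^TH_ku\ge\zeta\|u\|^2$ for $u\in\mathrm{Null}(J_k)\cup\mathrm{Null}(\bar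 J_k)$; these two null spaces are nontrivial; the nonzero singular values of $\bar J_k$ are at least $\kappa_\sigma$ (all for every $k$). Let $v_k$ be any $(\sigma_{Jc},\gamma_c)$-normal step for $(J_k,c_k)$ and let the columns of $Z_k$ be an orthonormal basis of $\mathrm{Null}(J_k)$. **Constants.** Let $K_J=\kappa_J+\epsilon_J$, $K_c=\kappa_c+\epsilon_c$, and * $\sigma_v=\frac12\bar\gamma_c\min\{\sigma_{Jc},K_J^{-2}\}$, $\underline\sigma=\sigma_v/(K_cK_J)$; * $\kappa_{\bar u}=\big((1+\zeta^{-1}\kappa_H)K_J\kappa_\sigma^{-2}+\zeta^{-1}\big)\lambda_{\rho r}\kappa_{\rho r}+\zeta^{-1}(\kappa_g+\epsilon_g+\kappa_H\sigma_{Jc}K_JK_c)$, $\kappa_{\bar d}=\kappa_{\bar u}+\sigma_{Jc}K_JK_c$; * for $t>0$: $\kappa_\Delta(t)=\min\{t\sigma_u\lambda_u,\sigma_c\sigma_v/K_c\}/\max\{2,2\sigma_{Jc}^2\}$, $\xi_{\min}(t)=\min\{\bar\xi_{-1},\frac{(1-\sigma_\xi)\sigma_u\lambda_u}{2(1+\bar\chi_{-1}^{-1})},(1-\sigma_\xi)\kappa_\Delta(t)\}$;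 for $\gamma>0$: $\kappa_{\Delta0}(\gamma)=\frac{\sigma_c\sigma_v\underline\sigma^2\gamma^4}{2K_c(\kappa_{\bar u}^2+\underline\sigma^2\gamma^4)\sigma_{Jc}^2}$; * $\alpha_u^A=\big(2(1-\eta)\bar\xi_{-1}\max\{\bar\tau_{-1},1\}/\Gamma+\theta\big)\beta$; $\alpha_{l\tau}^A(t)=2(1-\eta)\beta\xi_{\min}(t)\min\{\frac t{tL+\Gamma},\frac1{\bar\tau_{-1}L+\Gamma}\}$; $\alpha_{l\tau}^L(t)=\min\{\alpha_u^L,\frac{\nu(1-\eta)\kappa_\Delta(t)}{\bar\tau_{-1}L+\Gamma}\}$; $\alpha_{l0}^A(\gamma)=\min\{\frac{2(1-\eta)\beta\kappa_{\Delta0}(\gamma)}{\bar\tau_{-1}L+\Gamma},1,\theta\beta\}$; $\alpha_{l0}^L(\gamma)=\min\{\alpha_u^L,\frac{\nu(1-\eta)\kappa_{\Delta0}(\gamma)}{\bar\tau_{-1}L+\Gamma}\}$; * $\mathcal E_{Jc}=K_J\epsilon_c+\kappa_c\epsilon_J$, $\mathcal E_{Jc^1}=\mathcal E_{Jc}(K_JK_c+\kappa_J\kappa_c)$,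 $\mathcal E_{Jc^2}=\max\{\mathcal E_{Jc^1},\kappa_J^2\epsilon_c^2\}$; * $\mathcal E^A=\alpha_u^A\bar\tau_{-1}\kappa_{\bar d}\epsilon_g+2\epsilon_c+\alpha_u^A\kappa_{\bar d}\epsilon_J$, $\mathcal E^L=4\bar\tau_{-1}\epsilon_f+\bar\tau_{-1}\alpha_u^L\kappa_{\bar d}\epsilon_g+6\epsilon_c+\alpha_u^L\kappa_{\bar d}\epsilon_J$; * $\kappa_{\bar u^*}=\zeta^{-1}(\kappa_g+\epsilon_g+\kappa_H\sigma_{Jc}K_JK_c)$, $\kappa_{u^*}=\zeta^{-1}(\kappa_g+\kappa_H\sigma_{Jc}\kappa_J\kappa_c)$, $\kappa_{\bar y^*}=\kappa_\sigma^{-2}K_J(\kappa_g+\epsilon_g+\kappa_H(\kappa_{\bar u^*}+\sigma_{Jc}K_JK_c))$, $\kappa_{y^*}=\kappa_\sigma^{-2}\kappa_J(\kappa_g+\kappa_H(\kappa_{u^*}+\sigma_{Jc}\kappa_J\kappa_c))$; * $\kappa_1=4\lambda_{\rho r}^2(\zeta^{-1}+K_J\kappa_\sigma^{-2})^2$, $\kappa_2=24\zeta^{-2}\kappa_H^2\sigma_{Jc}^2$,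 $\mathcal E_{st}=\kappa_H^2\big(\kappa_1K_J^2\epsilon_c^2+12\zeta^{-2}(\epsilon_g^2+\kappa_{\bar y^*}^2\epsilon_J^2+\kappa_{y^*}^2\epsilon_J^2)\big)$; * $\phi(x,\tau)=\tau f(x)+\|c(x)\|$, $\phi_{\min}=\min\{0,\bar\tau_{-1}f_{\inf}\}$, $D=\bar\tau_{-1}|f_{\inf}|+\phi(x_0,\bar\tau_0)-\phi_{\min}$. **Theorem.** Let $i\in\{A,L\}$ be the step size rule, $\sigma_\epsilon>1$, $\epsilon>0$. "$P_k$ holds within $K$ iterations" means that $P_k$ holds for some $k\in\{0,\dots,K\}$. *(I) No condition on $\{\bar\tau_k\}$.* Let $\gamma>0$ with $\gamma\ge\mathcal E_{Jc}$, and $\alpha=\alpha_{l0}^i(\gamma)$. 1. If $\epsilon^2>\max\big\{4\gamma^2,\sigma_\epsilon\big(\mathcal E_{Jc^1}+\frac{K_c}{\eta\alpha\sigma_c\sigma_v}\mathcal E^i\big)\big\}$, then $\|J_k^Tc_k\|\le\epsilon$ holds within $\Big\lceil\frac{K_cD}{\eta\alpha\sigma_c\sigma_v(1-\sigma_\epsilon^{-1})\epsilon^2}\Big\rceil$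 iterations. 2. If all singular values of all $J_k$ are at least $\kappa_\sigma$ and $\epsilon^2>\max\big\{\frac{4\gamma^2}{\kappa_\sigma^2},\sigma_\epsilon\big(\frac{\mathcal E_{Jc^1}}{\kappa_\sigma^2}+\frac{K_c}{\eta\alpha\sigma_c\sigma_v\kappa_\sigma^2}\mathcal E^i\big)\big\}$, then $\|c_k\|\le\epsilon$ holds within $\Big\lceil\frac{K_cD}{\eta\alpha\sigma_c\sigma_v\kappa_\sigma^2(1-\sigma_\epsilon^{-1})\epsilon^2}\Big\rceil$ iterations. *(II) Merit parameters bounded away from zero.* Let $\bar\tau_{\min}>0$ with $\bar\tau_k\ge\bar\tau_{\min}$ for all $k$, and $\alpha=\alpha_{l\tau}^i(\bar\tau_{\min})$. 1. If $\epsilon^2>\sigma_\epsilon\big(\mathcal E_{Jc^2}+\frac{K_c}{\eta\alpha\sigma_c\sigma_v}\mathcal E^i\big)$, then $\|J_k^Tc_k\|\le\epsilon$ holds within $\Big\lceil\frac{K_cD}{\eta\alpha\sigma_c\sigma_v(1-\sigma_\epsilon^{-1})\epsilon^2}\Big\rceil$ iterations. 2. If all singular values of all $J_k$ are at least $\kappa_\sigma$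 and $\epsilon^2>\sigma_\epsilon\big(\frac{\mathcal E_{Jc^2}}{\kappa_\sigma^2}+\frac{K_c}{\eta\alpha\sigma_c\sigma_v\kappa_\sigma^2}\mathcal E^i\big)$, then $\|c_k\|\le\epsilon$ holds within $\Big\lceil\frac{K_cD}{\eta\alpha\sigma_c\sigma_v\kappa_\sigma^2(1-\sigma_\epsilon^{-1})\epsilon^2}\Big\rceil$ iterations. Let $a=\frac{\kappa_H^2(4+2\kappa_1)}{\bar\tau_{\min}\sigma_u\lambda_u\eta\alpha}$ and $$\kappa_{si}=a+\tfrac{(\kappa_H^2(\kappa_1+2\kappa_2)+1)K_c}{\sigma_c\sigma_v\eta\alpha},\quad\kappa_{sf}=a+\tfrac{(\kappa_\sigma^2\kappa_H^2(\kappa_1+2\kappa_2)+1)K_c}{\sigma_c\sigma_v\eta\alpha\kappa_\sigma^2},\quad\kappa_{\overline{sf}}=a+\tfrac{\kappa_\sigma^2\kappa_H^2(\kappa_1+2\kappa_2)K_c+1}{\sigma_c\sigma_v\eta\alpha\kappa_\sigma^2}.$$ 3. If $\epsilon^2>\sigma_\epsilon\big(\kappa_{si}\mathcal E^i+(2\kappa_H^2\kappa_2+1)\mathcal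 E_{Jc^2}+\mathcal E_{st}\big)$, then $\|Z_k^T(\nabla f(x_k)+H_kv_k)\|\le\epsilon$ and $\|J_k^Tc_k\|\le\epsilon$ hold simultaneously within $\Big\lceil\frac{\kappa_{si}D}{(1-\sigma_\epsilon^{-1})\epsilon^2}\Big\rceil$ iterations. 4. If all singular values of all $J_k$ are at least $\kappa_\sigma$ and $\epsilon^2>\sigma_\epsilon\big(\kappa_{sf}\mathcal E^i+(2\kappa_H^2\kappa_2+\kappa_\sigma^{-2})\mathcal E_{Jc^2}+\mathcal E_{st}\big)$, then $\|Z_k^T(\nabla f(x_k)+H_kv_k)\|\le\epsilon$ and $\|c_k\|\le\epsilon$ hold simultaneously within $\Big\lceil\frac{\kappa_{sf}D}{(1-\sigma_\epsilon^{-1})\epsilon^2}\Big\rceil$ iterations. 5. If all singular values of all $\bar J_k$ are at least $\kappa_\sigma$ and $\epsilon^2>\sigma_\epsilon\big(\kappa_{\overline{sf}}\mathcal E^i+2\kappa_H^2\kappa_2\mathcal E_{Jc^2}+2\epsilon_c+\mathcal E_{st}\big)$, then $\|Z_k^T(\nabla f(x_k)+H_kv_k)\|\le\epsilon$ and $\sqrt{\|c_k\|}\le\epsilon$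 hold simultaneously within $\Big\lceil\frac{\kappa_{\overline{sf}}D}{(1-\sigma_\epsilon^{-1})\epsilon^2}\Big\rceil$ iterations. All constants depend only on the parameters and bounds listed above (and on $\gamma$, $\bar\tau_{\min}$ where indicated), so that for fixed such data the bounds are $\mathcal O(\epsilon^{-2})$. -/

import Mathlib

/-! A noise-aware sequential quadratic programming method for `min f(x)` subject to `c(x) = 0`,
`f : ℝⁿ → ℝ`, `c : ℝⁿ → ℝᵐ`, when only noisy values of `f`, `∇f`, `c` and of the Jacobian of `c`
are available. -/

noncomputable section

namespace NoisySQP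

/-- `ℝⁿ` with the Euclidean norm and inner product. -/
abbrev Vec (n : ℕ) := EuclideanSpace ℝ (Fin n)

/-- Transpose of an `m × n` matrix, seen as a linear map `ℝⁿ → ℝᵐ`. -/
abbrev tr {n m : ℕ} (J : Vec n →L[ℝ] Vec m) : Vec m →L[ℝ] Vec n := ContinuousLinearMap.adjoint J

/-- The true objective and constraint functions, and the noisy estimates of the two functions and
of their first derivatives. -/
structure NoisyProblem (n m : ℕ) where
  f : Vec n → ℝ
  c : Vec n → Vec m
  fbar : Vec n → ℝ
  gbar : Vec n → Vec n
  cbar : Vec n → Vec m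
  Jbar : Vec n → (Vec n →L[ℝ] Vec m)

/-- The true constraint Jacobian. -/
def NoisyProblem.J {n m : ℕ} (P : NoisyProblem n m) (x : Vec n) : Vec n →L[ℝ] Vec m :=
  fderiv ℝ P.c x

/-- The two step size rules: the adaptive one (Option I) and the line search (Option II). -/
inductive StepRule where
  | adaptive
  | lineSearch

/-- Problem constants, noise levels and user-defined parameters. A trailing `0` marks an initial
value, i.e. the value with index `-1`. -/
structure Params where
  /-- lower bound for the objective -/
  fInf : ℝ
  /-- bounds for the objective gradient, the constraint function and its Jacobian -/
  κg : ℝ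
  κc : ℝ
  κJ : ℝ
  /-- Lipschitz constants of the objective gradient and of the constraint Jacobian -/
  L : ℝ
  Γ : ℝ
  /-- noise levels -/
  εf : ℝ
  εg : ℝ
  εc : ℝ
  εJ : ℝ
  /-- bound and curvature constant of the matrices `H_k` -/
  κH : ℝ
  ζ : ℝ
  /-- lower bound for singular values -/
  κσ : ℝ
  /-- optimistic feasibility parameter -/
  εo : ℝ
  /-- trust-region factor and Cauchy decrease fractions (noisy and true normal step) -/
  σJc : ℝ
  γcbar : ℝ
  γc : ℝ
  /-- parameters of the termination tests and of the merit parameter update -/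
  lamρr : ℝ
  κρr : ℝ
  lamu : ℝ
  lamuv : ℝ
  lamv : ℝ
  σu : ℝ
  σc : ℝ
  σr : ℝ
  στ : ℝ
  τ0 : ℝ
  /-- sufficient decrease parameter -/
  η : ℝ
  /-- parameters of the adaptive step size rule -/
  σχ : ℝ
  σζ : ℝ
  σξ : ℝ
  β : ℝ
  θ : ℝ
  χ0 : ℝ
  ζ0 : ℝ
  ξ0 : ℝ
  /-- initial trial step and backtracking factor of the line search -/
  αuL : ℝ
  ν : ℝ

namespace Params

/-- The admissible ranges of the constants and parameters that are used with either rule. -/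
structure ValidCommon (p : Params) : Prop where
  κg : 0 < p.κg
  κc : 0 < p.κc
  κJ : 0 < p.κJ
  L : 0 < p.L
  Γ : 0 ≤ p.Γ
  εf : 0 ≤ p.εf
  εg : 0 ≤ p.εg
  εc : 0 ≤ p.εc
  εJ : 0 ≤ p.εJ
  κH : 0 < p.κH
  ζ : 0 < p.ζ
  κσ : 0 < p.κσ
  εo : 0 ≤ p.εo ∧ p.εo ≤ p.εc
  σJc : 0 < p.σJc
  γcbar : 0 < p.γcbar ∧ p.γcbar ≤ 1
  γc : 0 < p.γc ∧ p.γc ≤ 1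
  lamρr : 0 < p.lamρr ∧ p.lamρr < 1
  κρr : 0 < p.κρr
  lamu : 0 < p.lamu ∧ p.lamu < p.ζ
  lamuv : 0 < p.lamuv
  lamv : 0 < p.lamv
  σu : 0 < p.σu ∧ p.σu < 1
  σc : 0 < p.σc ∧ p.σc < 1
  σr : p.σc < p.σr ∧ p.σr < 1
  στ : 0 < p.στ ∧ p.στ < 1
  τ0 : 0 < p.τ0
  η : 0 < p.η ∧ p.η < 1

/-- The admissible ranges of the parameters of the adaptive rule. -/
structure ValidAdaptive (p : Params) : Prop where
  Γ : 0 < p.Γ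
  σχ : 0 < p.σχ
  σζ : 0 < p.σζ ∧ p.σζ < 1
  σξ : 0 < p.σξ ∧ p.σξ < 1
  β : 0 < p.β ∧ p.β ≤ 1
  θ : 0 < p.θ
  χ0 : 0 < p.χ0
  ζ0 : 0 < p.ζ0
  ξ0 : 0 < p.ξ0
  /-- the two conditions that keep the lower safeguard of the step size below one -/
  small : 2 * (1 - p.η) * p.β * p.ξ0 * p.τ0 / (p.τ0 * p.L + p.Γ) ≤ 1
  small' : 2 * (1 - p.η) * p.β * p.ξ0 / p.Γ ≤ 1

/-- The admissible ranges of the parameters of the line search. -/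
structure ValidLineSearch (p : Params) : Prop where
  αuL : 0 < p.αuL ∧ p.αuL ≤ 1
  ν : 0 < p.ν ∧ p.ν < 1

/-- The parameters are admissible for the given step size rule. -/
def Valid (p : Params) : StepRule → Prop
  | .adaptive => p.ValidCommon ∧ p.ValidAdaptive
  | .lineSearch => p.ValidCommon ∧ p.ValidLineSearch

end Params

/-- The assumptions on the functions and on the noise over the set `X`. -/
structure Regular {n m : ℕ} (P : NoisyProblem n m) (p : Params) (X : Set (Vec n)) : Prop where
  isOpen : IsOpen X
  convex : Convex ℝ X
  f_diff : DifferentiableOn ℝ P.f X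
  f_lower : ∀ x ∈ X, p.fInf ≤ P.f x
  g_bound : ∀ x ∈ X, ‖gradient P.f x‖ ≤ p.κg
  g_lip : ∀ x ∈ X, ∀ y ∈ X, ‖gradient P.f x - gradient P.f y‖ ≤ p.L * ‖x - y‖
  c_diff : DifferentiableOn ℝ P.c X
  c_bound : ∀ x ∈ X, ‖P.c x‖ ≤ p.κc
  J_bound : ∀ x ∈ X, ‖P.J x‖ ≤ p.κJ
  J_lip : ∀ x ∈ X, ∀ y ∈ X, ‖P.J x - P.J y‖ ≤ p.Γ * ‖x - y‖
  noise_f : ∀ x ∈ X, |P.fbar x - P.f x| ≤ p.εf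
  noise_g : ∀ x ∈ X, ‖P.gbar x - gradient P.f x‖ ≤ p.εg
  noise_c : ∀ x ∈ X, ‖P.cbar x - P.c x‖ ≤ p.εc
  noise_J : ∀ x ∈ X, ‖P.Jbar x - P.J x‖ ≤ p.εJ

/-- All quantities produced along the iterations: iterates `x`, noisy normal steps `vbar`, noisy
tangential steps `ubar` with multipliers `ybar`, matrices `H`, merit parameters `τ`, step sizes
`α`, the auxiliary sequences `χ`, `ζ`, `ξ` of the adaptive rule; finally the (never computed) normal
steps `v` of the true problem. -/
structure Iterates (n m : ℕ) where
  x : ℕ → Vec n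
  vbar : ℕ → Vec n
  ubar : ℕ → Vec n
  ybar : ℕ → Vec m
  H : ℕ → (Vec n →L[ℝ] Vec n)
  τ : ℕ → ℝ
  α : ℕ → ℝ
  χ : ℕ → ℝ
  ζ : ℕ → ℝ
  ξ : ℕ → ℝ
  v : ℕ → Vec n

/-- `prev a₀ a k` is `a (k - 1)`, where the value with index `-1` is `a₀`. -/
def prev (a₀ : ℝ) (a : ℕ → ℝ) : ℕ → ℝ
  | 0 => a₀
  | k + 1 => a k

/-- Length of the Cauchy step along `-Jᵀ c` for the subproblem with trust-region factor `σ`. -/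
def cauchyLength {n m : ℕ} (σ : ℝ) (J : Vec n →L[ℝ] Vec m) (c : Vec m) : ℝ :=
  min σ (‖tr J c‖ ^ 2 / ‖J (tr J c)‖ ^ 2)

/-- `v` is an approximate solution of `min ½‖c + J v‖²` over `v ∈ Range(Jᵀ)`, `‖v‖ ≤ σ ‖Jᵀ c‖`:
it is feasible and achieves the fraction `γ` of the decrease achieved by the Cauchy step. -/
structure IsNormalStep {n m : ℕ} (σ γ : ℝ) (J : Vec n →L[ℝ] Vec m) (c : Vec m) (v : Vec n) :
    Prop where
  mem_range : v ∈ LinearMap.range (tr J).toLinearMap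
  norm_le : ‖v‖ ≤ σ * ‖tr J c‖
  cauchy : γ * (‖c‖ - ‖c + cauchyLength σ J c • J (-(tr J c))‖) ≤ ‖c‖ - ‖c + J v‖

section Iteration

variable {n m : ℕ} (P : NoisyProblem n m) (p : Params) (R : Iterates n m) (k : ℕ)

/-- The reduction `-τ ḡ(x)ᵀ d + ‖c̄(x)‖ - ‖c̄(x) + J̄(x) d‖` of the model of the merit function. -/
def modelRed (x : Vec n) (τ : ℝ) (d : Vec n) : ℝ :=
  -τ * inner ℝ (P.gbar x) d + ‖P.cbar x‖ - ‖P.cbar x + P.Jbar x d‖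

/-- The exact merit function `τ f + ‖c‖`. -/
def merit (x : Vec n) (τ : ℝ) : ℝ := τ * P.f x + ‖P.c x‖

/-- The noisy merit function `τ f̄ + ‖c̄‖`. -/
def noisyMerit (x : Vec n) (τ : ℝ) : ℝ := τ * P.fbar x + ‖P.cbar x‖

/-- Quantities at the iterate `x_k`. -/
def gk : Vec n := P.gbar (R.x k)
/-- The noisy constraint value at `x_k`. -/
def ck : Vec m := P.cbar (R.x k)
/-- The noisy Jacobian at `x_k`. -/
def Jk : Vec n →L[ℝ] Vec m := P.Jbar (R.x k)
/-- The vector `J̄_kᵀ c̄_k`. -/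
def JTck : Vec n := tr (Jk P R k) (ck P R k)
/-- The search direction. -/
def dk : Vec n := R.vbar k + R.ubar k
/-- The dual residual of the linear system for the tangential step. -/
def ρk : Vec n :=
  R.H k (R.ubar k) + tr (Jk P R k) (R.ybar k) + (gk P R k + R.H k (R.vbar k))
/-- The primal residual of the linear system for the tangential step. -/
def rk : Vec m := Jk P R k (R.ubar k)
/-- The merit parameter before the update in iteration `k`. -/
def τprev : ℝ := prev p.τ0 R.τ k
/-- The model reduction for the updated merit parameter and the search direction. -/
def Δk : ℝ := modelRed P (R.x k) (R.τ k) (dk R k)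
/-- The curvature `ūᵀ H ū`. -/
def curv : ℝ := inner ℝ (R.ubar k) (R.H k (R.ubar k))
/-- `max {ūᵀ H ū, λ_u ‖ū‖²}`. -/
def curvMax : ℝ := max (curv R k) (p.lamu * ‖R.ubar k‖ ^ 2)
/-- The decrease of the linearized constraint violation along the normal step. -/
def normalRed : ℝ := ‖ck P R k‖ - ‖ck P R k + Jk P R k (R.vbar k)‖
/-- The decrease of the linearized constraint violation along the full step. -/
def fullRed : ℝ := ‖ck P R k‖ - ‖ck P R k + Jk P R k (R.vbar k) + rk P R k‖

/-- The bound on the residuals which is common to the two termination tests. -/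
def ResidualSmall : Prop :=
  max ‖ρk P R k‖ ‖rk P R k‖ ≤ p.lamρr * min (max ‖R.ubar k‖ ‖JTck P R k‖) p.κρr

/-- The first termination test, for iterates with `‖c̄_k‖ ≤ ε_o`. -/
structure TermTest1 : Prop where
  resid : ResidualSmall P p R k
  curvature : p.lamu * ‖R.ubar k‖ ^ 2 - p.εo ≤ curv R k
  descent : inner ℝ (gk P R k) (R.ubar k) + 1 / 2 * curv R k ≤ p.εo
  model : τprev p R k * p.σu * curvMax p R k - p.εo
    ≤ modelRed P (R.x k) (τprev p R k) (R.ubar k)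

/-- Sufficient model reduction with the old merit parameter. -/
def ModelCond : Prop :=
  τprev p R k * p.σu * curvMax p R k + p.σc * normalRed P R k
    ≤ modelRed P (R.x k) (τprev p R k) (dk R k)

/-- Sufficient decrease of the linearized constraint violation. -/
def FeasCond : Prop :=
  p.σr * normalRed P R k ≤ fullRed P R k ∧ 0 < p.σr * normalRed P R k

/-- The second termination test, for iterates with `‖c̄_k‖ > ε_o`. -/
structure TermTest2 : Prop where
  resid : ResidualSmall P p R k
  tangential : ‖R.ubar k‖ ≤ p.lamuv * ‖R.vbar k‖ ∨
    (p.lamu * ‖R.ubar k‖ ^ 2 ≤ curv R k ∧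
      inner ℝ (gk P R k + R.H k (R.vbar k)) (R.ubar k)
        + max (1 / 2) (1 - ‖JTck P R k‖) * curv R k ≤ p.lamv * ‖R.vbar k‖)
  either : ModelCond P p R k ∨ FeasCond P p R k

/-- The denominator `ḡᵀ d̄ + max {ūᵀ H ū, λ_u ‖ū‖²}` of the trial merit parameter. -/
def τden : ℝ := inner ℝ (gk P R k) (dk R k) + curvMax p R k

/-- The trial merit parameter when it is finite, i.e. when `τden` is positive. -/
def τtrial : ℝ := (1 - p.σc / p.σr) * fullRed P R k / τden P p R k

open Classical in
/-- The updated merit parameter when `‖c̄_k‖ > ε_o`. If `τden ≤ 0` the trial value is `∞`. -/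
def τnext : ℝ :=
  if ModelCond P p R k then τprev p R k
  else if τden P p R k ≤ 0 then τprev p R k
  else if τprev p R k ≤ (1 - p.στ) * τtrial P p R k then τprev p R k
  else (1 - p.στ) * τtrial P p R k

/-- Computation of the search direction and update of the merit parameter, together with the
assumption that the method does not terminate in iteration `k`. -/
structure Direction : Prop where
  small : ‖ck P R k‖ ≤ p.εo →
    R.vbar k = 0 ∧ R.τ k = τprev p R k ∧ TermTest1 P p R k ∧ p.εo < Δk P R k
  large : p.εo < ‖ck P R k‖ →
    JTck P R k ≠ 0 ∧ IsNormalStep p.σJc p.γcbar (Jk P R k) (ck P R k) (R.vbar k) ∧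
      TermTest2 P p R k ∧ R.τ k = τnext P p R k

/-- The step is tangentially dominated, for the threshold `χ`. -/
def TangDom (χ : ℝ) : Prop := χ * ‖R.vbar k‖ ^ 2 ≤ ‖R.ubar k‖ ^ 2

/-- The condition for an update of the sequences `χ` and `ζ`. -/
def DomCond : Prop :=
  TangDom R k (prev p.χ0 R.χ k) ∧
    1 / 2 * inner ℝ (dk R k) (R.H k (dk R k)) < 1 / 4 * prev p.ζ0 R.ζ k * ‖R.ubar k‖ ^ 2

open Classical in
/-- The trial value for `ξ_k`. -/
def ξtrial : ℝ :=
  if TangDom R k (R.χ k) then Δk P R k / (R.τ k * ‖dk R k‖ ^ 2) else Δk P R k / ‖dk R k‖ ^ 2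

/-- The unsafeguarded adaptive step size. -/
def αsuff : ℝ :=
  min (2 * (1 - p.η) * p.β * Δk P R k / ((R.τ k * p.L + p.Γ) * ‖dk R k‖ ^ 2)) 1

open Classical in
/-- The lower safeguard. -/
def αmin : ℝ :=
  if TangDom R k (R.χ k) then 2 * (1 - p.η) * p.β * R.ξ k * R.τ k / (R.τ k * p.L + p.Γ)
  else 2 * (1 - p.η) * p.β * R.ξ k / (R.τ k * p.L + p.Γ)

/-- The upper safeguard. -/
def αmax : ℝ := αmin p R k + p.θ * p.β

open Classical in
/-- The adaptive step size rule: the step size is the projection of `αsuff` onto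
`[αmin, αmax]`. -/
structure AdaptiveStep : Prop where
  χ_eq : R.χ k = if DomCond p R k then (1 + p.σχ) * prev p.χ0 R.χ k else prev p.χ0 R.χ k
  ζ_eq : R.ζ k = if DomCond p R k then (1 - p.σζ) * prev p.ζ0 R.ζ k else prev p.ζ0 R.ζ k
  ξ_eq : R.ξ k = if prev p.ξ0 R.ξ k ≤ ξtrial P R k then prev p.ξ0 R.ξ k
    else min ((1 - p.σξ) * prev p.ξ0 R.ξ k) (ξtrial P R k)
  α_eq : R.α k = max (αmin p R k) (min (αsuff P p R k) (αmax p R k))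

/-- The relaxation term of the line search. -/
def relax : ℝ :=
  2 * R.τ k * p.εf + 4 * p.εc + R.τ k * p.αuL * p.εg * ‖dk R k‖ + p.αuL * p.εJ * ‖dk R k‖

/-- The relaxed sufficient decrease condition for the trial step size `a`. -/
def Armijo (a : ℝ) : Prop :=
  noisyMerit P (R.x k + a • dk R k) (R.τ k)
    ≤ noisyMerit P (R.x k) (R.τ k) - p.η * a * Δk P R k + relax p R k

/-- Backtracking: the first of the step sizes `α_u, ν α_u, ν² α_u, …` which is acceptable. -/
def LineSearchStep : Prop :=
  ∃ j : ℕ, R.α k = p.αuL * p.ν ^ j ∧ Armijo P p R k (p.αuL * p.ν ^ j) ∧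
    ∀ i < j, ¬ Armijo P p R k (p.αuL * p.ν ^ i)

/-- The step size is chosen by the given rule. -/
def StepSize : StepRule → Prop
  | .adaptive => AdaptiveStep P p R k
  | .lineSearch => LineSearchStep P p R k

end Iteration

/-- All singular values of `J : ℝⁿ → ℝᵐ` (there are `min n m`) are at least `κ`. -/
def SingularValuesGE {n m : ℕ} (κ : ℝ) (J : Vec n →L[ℝ] Vec m) : Prop :=
  ∀ i < min n m, κ ≤ J.toLinearMap.singularValues i

/-- All nonzero singular values of `J` are at least `κ`. -/
def NonzeroSingularValuesGE {n m : ℕ} (κ : ℝ) (J : Vec n →L[ℝ] Vec m) : Prop :=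
  ∀ i, J.toLinearMap.singularValues i ≠ 0 → κ ≤ J.toLinearMap.singularValues i

/-- `R` is an infinite run of the method with the given step size rule, with the assumptions on its
iterates, on the matrices `H_k` and on the Jacobians at the iterates; `R.v` are normal steps of the
true problem. -/
structure IsRun {n m : ℕ} (P : NoisyProblem n m) (p : Params) (rule : StepRule)
    (X : Set (Vec n)) (R : Iterates n m) : Prop where
  x_mem : ∀ k, R.x k ∈ X
  trial_mem : ∀ k, R.x k + dk R k ∈ X
  direction : ∀ k, Direction P p R k
  stepSize : ∀ k, StepSize P p R k rule
  update : ∀ k, R.x (k + 1) = R.x k + R.α k • dk R k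
  H_bound : ∀ k, ‖R.H k‖ ≤ p.κH
  H_curv : ∀ k u, P.J (R.x k) u = 0 ∨ P.Jbar (R.x k) u = 0 →
    p.ζ * ‖u‖ ^ 2 ≤ inner ℝ u (R.H k u)
  ker_J : ∀ k, LinearMap.ker (P.J (R.x k)).toLinearMap ≠ ⊥
  ker_Jbar : ∀ k, LinearMap.ker (P.Jbar (R.x k)).toLinearMap ≠ ⊥
  sv_Jbar : ∀ k, NonzeroSingularValuesGE p.κσ (P.Jbar (R.x k))
  trueStep : ∀ k, IsNormalStep p.σJc p.γc (P.J (R.x k)) (P.c (R.x k)) (R.v k)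

/-- `Z` is an `n × q` matrix whose columns form an orthonormal basis of the null space of `J`. -/
def IsNullBasis {n m q : ℕ} (J : Vec n →L[ℝ] Vec m) (Z : Vec q →ₗᵢ[ℝ] Vec n) : Prop :=
  LinearMap.range Z.toLinearMap = LinearMap.ker J.toLinearMap

/-- The stationarity error `‖Z_kᵀ (∇f(x_k) + H_k v_k)‖`. -/
def statErr {n m q : ℕ} (P : NoisyProblem n m) (R : Iterates n m) (k : ℕ)
    (Z : Vec q →ₗᵢ[ℝ] Vec n) : ℝ :=
  ‖tr Z.toContinuousLinearMap (gradient P.f (R.x k) + R.H k (R.v k))‖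

/-- The infeasible stationarity error `‖J_kᵀ c_k‖`. -/
def infErr {n m : ℕ} (P : NoisyProblem n m) (R : Iterates n m) (k : ℕ) : ℝ :=
  ‖tr (P.J (R.x k)) (P.c (R.x k))‖

/-- The feasibility error `‖c_k‖`. -/
def feasErr {n m : ℕ} (P : NoisyProblem n m) (R : Iterates n m) (k : ℕ) : ℝ := ‖P.c (R.x k)‖

namespace Params

variable (p : Params)

/-! The explicit constants of the complexity bounds. -/

/-- Bounds for the norms of the noisy Jacobian and of the noisy constraint value. -/
def KJ : ℝ := p.κJ + p.εJ
/-- Bound for the norm of the noisy constraint value. -/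
def Kc : ℝ := p.κc + p.εc

/-- Constant in the lower bound for the decrease along the noisy normal step. -/
def σv : ℝ := 1 / 2 * p.γcbar * min p.σJc (1 / p.KJ ^ 2)
/-- Constant in the lower bound for the length of the noisy normal step. -/
def σlow : ℝ := p.σv / (p.Kc * p.KJ)

/-- Bound for the noisy tangential steps. -/
def κu : ℝ :=
  ((1 + p.ζ⁻¹ * p.κH) * p.KJ * (p.κσ ^ 2)⁻¹ + p.ζ⁻¹) * (p.lamρr * p.κρr)
    + p.ζ⁻¹ * (p.κg + p.εg + p.κH * p.σJc * p.KJ * p.Kc)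
/-- Bound for the search directions. -/
def κd : ℝ := p.κu + p.σJc * p.KJ * p.Kc

/-- Ratio of model reduction and squared step length, when the merit parameters are at least
`τmin`. -/
def κΔ (τmin : ℝ) : ℝ :=
  min (τmin * p.σu * p.lamu) (p.σc * p.σv / p.Kc) / max 2 (2 * p.σJc ^ 2)
/-- Ratio of model reduction and squared step length, at iterates with `‖J̄ᵀ c̄‖ ≥ γ` and
`‖c̄‖ > ε_o`. -/
def κΔ0 (γ : ℝ) : ℝ :=
  p.σc * p.σv * p.σlow ^ 2 * γ ^ 4
    / (2 * p.Kc * (p.κu ^ 2 + p.σlow ^ 2 * γ ^ 4) * p.σJc ^ 2)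

/-- Lower bound for the sequence `ξ`, when the merit parameters are at least `τmin`. -/
def ξmin (τmin : ℝ) : ℝ :=
  min p.ξ0 (min ((1 - p.σξ) * p.σu * p.lamu / (2 * (1 + p.χ0⁻¹))) ((1 - p.σξ) * p.κΔ τmin))

/-- Upper bound for the step sizes. -/
def αup : StepRule → ℝ
  | .adaptive => (2 * (1 - p.η) * p.ξ0 * max p.τ0 1 / p.Γ + p.θ) * p.β
  | .lineSearch => p.αuL

/-- Lower bound for the step sizes, when the merit parameters are at least `τmin`. -/
def αlow (τmin : ℝ) : StepRule → ℝ
  | .adaptive => 2 * (1 - p.η) * p.β * p.ξmin τmin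
      * min (τmin / (τmin * p.L + p.Γ)) (1 / (p.τ0 * p.L + p.Γ))
  | .lineSearch => min p.αuL (p.ν * (1 - p.η) * p.κΔ τmin / (p.τ0 * p.L + p.Γ))

/-- Lower bound for the step sizes at iterates with `‖J̄ᵀ c̄‖ ≥ γ` and `‖c̄‖ > ε_o`. -/
def αlow0 (γ : ℝ) : StepRule → ℝ
  | .adaptive => min ((1 - p.η) * p.β * p.σc * p.σv * p.σlow ^ 2 * γ ^ 4
      / ((p.τ0 * p.L + p.Γ) * p.Kc * p.σJc ^ 2 * (p.κu ^ 2 + p.σlow ^ 2 * γ ^ 4)))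
      (min 1 (p.θ * p.β))
  | .lineSearch => min p.αuL (p.ν * (1 - p.η) * p.κΔ0 γ / (p.τ0 * p.L + p.Γ))

/-- Bound for `‖J_kᵀ c_k - J̄_kᵀ c̄_k‖`. -/
def EJc : ℝ := p.KJ * p.εc + p.κc * p.εJ
/-- Bound for the difference of the squared norms. -/
def EJc1 : ℝ := p.EJc * (p.KJ * p.Kc + p.κJ * p.κc)
/-- The same, when `J̄_kᵀ c̄_k` is replaced by zero at iterates with `‖c̄_k‖ ≤ ε_o`. -/
def EJc2 : ℝ := max p.EJc1 (p.κJ ^ 2 * p.εc ^ 2)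

/-- The noise term in the decrease of the exact merit function. -/
def Emerit : StepRule → ℝ
  | .adaptive => p.αup .adaptive * p.τ0 * p.κd * p.εg + 2 * p.εc
      + p.αup .adaptive * p.κd * p.εJ
  | .lineSearch => 4 * p.τ0 * p.εf + p.τ0 * p.αup .lineSearch * p.κd * p.εg + 6 * p.εc
      + p.αup .lineSearch * p.κd * p.εJ

/-- Bounds for the exact tangential steps of the noisy and of the true problem. -/
def κubarStar : ℝ := p.ζ⁻¹ * (p.κg + p.εg + p.κH * p.σJc * p.KJ * p.Kc)
/-- Bound for the exact tangential step of the true problem. -/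
def κuStar : ℝ := p.ζ⁻¹ * (p.κg + p.κH * p.σJc * p.κJ * p.κc)
/-- Bounds for the corresponding multipliers. -/
def κybarStar : ℝ :=
  (p.κσ ^ 2)⁻¹ * p.KJ * (p.κg + p.εg + p.κH * (p.κubarStar + p.σJc * p.KJ * p.Kc))
/-- Bound for the multiplier of the true problem. -/
def κyStar : ℝ := (p.κσ ^ 2)⁻¹ * p.κJ * (p.κg + p.κH * (p.κuStar + p.σJc * p.κJ * p.κc))

/-- The constant `κ₁`. -/
def κ1 : ℝ := 4 * p.lamρr ^ 2 * (p.ζ⁻¹ + p.KJ * (p.κσ ^ 2)⁻¹) ^ 2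
/-- The constant `κ₂`. -/
def κ2 : ℝ := 24 * (p.ζ ^ 2)⁻¹ * p.κH ^ 2 * p.σJc ^ 2

/-- The noise term in the stationarity error that comes from the perturbed subproblems. -/
def Estat : ℝ :=
  p.κH ^ 2 * (p.κ1 * p.KJ ^ 2 * p.εc ^ 2
    + 12 * (p.ζ ^ 2)⁻¹ * (p.εg ^ 2 + p.κybarStar ^ 2 * p.εJ ^ 2 + p.κyStar ^ 2 * p.εJ ^ 2))

/-- Complexity constant for stationarity and infeasible stationarity. -/
def κsi (τmin : ℝ) (rule : StepRule) : ℝ :=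
  p.κH ^ 2 * (4 + 2 * p.κ1) / (τmin * p.σu * p.lamu * p.η * p.αlow τmin rule)
    + (p.κH ^ 2 * (p.κ1 + 2 * p.κ2) + 1) * p.Kc / (p.σc * p.σv * p.η * p.αlow τmin rule)

/-- Complexity constant for stationarity and feasibility, full-rank true Jacobians. -/
def κsf (τmin : ℝ) (rule : StepRule) : ℝ :=
  p.κH ^ 2 * (4 + 2 * p.κ1) / (τmin * p.σu * p.lamu * p.η * p.αlow τmin rule)
    + (p.κσ ^ 2 * p.κH ^ 2 * (p.κ1 + 2 * p.κ2) + 1) * p.Kc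
      / (p.σc * p.σv * p.η * p.αlow τmin rule * p.κσ ^ 2)

/-- Complexity constant for stationarity and feasibility, full-rank noisy Jacobians. -/
def κsfbar (τmin : ℝ) (rule : StepRule) : ℝ :=
  p.κH ^ 2 * (4 + 2 * p.κ1) / (τmin * p.σu * p.lamu * p.η * p.αlow τmin rule)
    + (p.κσ ^ 2 * p.κH ^ 2 * (p.κ1 + 2 * p.κ2) * p.Kc + 1)
      / (p.σc * p.σv * p.η * p.αlow τmin rule * p.κσ ^ 2)

/-- Lower bound `min {0, τ₋₁ f_inf}` for the merit function. -/
def φmin : ℝ := min 0 (p.τ0 * p.fInf)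

end Params

/-- The initial gap `τ₋₁ |f_inf| + φ(x₀, τ₀) - φ_min`. -/
def gap {n m : ℕ} (P : NoisyProblem n m) (p : Params) (R : Iterates n m) : ℝ :=
  p.τ0 * |p.fInf| + merit P (R.x 0) (R.τ 0) - p.φmin

end NoisySQP

end

/-! In every iteration the exact merit function `τ f + ‖c‖` decreases by `η α_k Δ_k`, up to the
noise term `Emerit` (`merit_succ_le`). It is bounded below, and all reductions of `τ` together cost
at most `τ0 |fInf|`. Hence if each of the first `N` iterations gains `δ` beyond the noise, then `N δ
≤ gap` (`mul_le_gap`, `exists_le_ceil`). It remains to show that an error above `ε` forces `η α_k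
Δ_k` to be at least a multiple of `ε²` minus noise.

Model reduction: if `‖c̄_k‖ > εo`, the update of `τ` keeps `Δ_k` above a multiple of `τ_k ‖ū_k‖²`
plus a multiple of the decrease along the normal step, and the Cauchy condition bounds that decrease
below by `σv ‖J̄ᵀc̄‖² / Kc` (`IsNormalStep.decrease`). If `‖c̄_k‖ ≤ εo`, only the tangential term is
available, and the slack `εo` in the test is absorbed because the method has not stopped.

Step sizes: a lower bound follows from `Δ_k ≥ κ ‖d̄_k‖²`. If `τ_k ≥ τmin`, both components of `d̄_k`
are controlled by `Δ_k` (`κΔ_mul_le`). Otherwise the tangential term may degenerate, but `‖J̄ᵀc̄‖ ≥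
γ` forces a long normal step while `ū_k` is bounded, so the normal part controls everything
(`κΔ0_mul_le`).

Errors: `‖Jᵀc‖²` and `‖J̄ᵀc̄‖²` differ by noise. For stationarity a null vector of `J` is projected
onto the null space of `J̄`, where the computed dual residual removes the multiplier; the projection
error is proportional to `εJ` (`statErr_le`). The squared errors are then bounded by `‖ū‖²`, the
normal decrease and noise, hence by `Δ_k` and noise. -/

noncomputable section

namespace NoisySQP

/-! ### Singular values, transposes and the Cauchy decrease -/

section LinearAlgebra

variable {n m : ℕ}

/-- On the orthogonal complement of its kernel, a map whose nonzero singular values are at least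
`κ` expands lengths by at least `κ`. -/
lemma NonzeroSingularValuesGE.mul_norm_le {κ : ℝ} (hκ : 0 ≤ κ) {J : Vec n →L[ℝ] Vec m}
    (hJ : NonzeroSingularValuesGE κ J) {w : Vec n}
    (hw : w ∈ (LinearMap.ker J.toLinearMap)ᗮ) : κ * ‖w‖ ≤ ‖J w‖ := by
  set T := J.toLinearMap with hT
  have hn : Module.finrank ℝ (Vec n) = n := by simp
  have hS := T.isSymmetric_adjoint_comp_self
  set b := hS.eigenvectorBasis hn with hb
  have happ : ∀ i : Fin n, (LinearMap.adjoint T ∘ₗ T) (b i) = (T.singularValues i ^ 2) • b i := by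
    intro i
    rw [T.sq_singularValues_fin hn i]
    exact hS.apply_eigenvectorBasis hn i
  -- In an eigenbasis of `JᵀJ`, whose eigenvalues are the squared singular values, the claim becomes
  -- a termwise comparison; the terms with singular value zero vanish because `w` is orthogonal to
  -- the kernel.
  have hJw : ‖J w‖ ^ 2 = ∑ i : Fin n, T.singularValues i ^ 2 * (inner ℝ (b i) w) ^ 2 := by
    have h1 : ‖J w‖ ^ 2 = inner ℝ w ((LinearMap.adjoint T ∘ₗ T) w) := by
      rw [LinearMap.comp_apply, LinearMap.adjoint_inner_right, real_inner_self_eq_norm_sq]; rfl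
    rw [h1, ← b.sum_inner_mul_inner]
    refine Finset.sum_congr rfl fun i _ => ?_
    rw [← hS (b i) w, happ i, real_inner_smul_left, real_inner_comm w]
    ring
  have hsq : (κ * ‖w‖) ^ 2 ≤ ‖J w‖ ^ 2 := by
    rw [hJw, mul_pow, ← real_inner_self_eq_norm_sq, ← b.sum_inner_mul_inner, Finset.mul_sum]
    refine Finset.sum_le_sum fun i _ => ?_
    rw [real_inner_comm (b i) w, ← sq]
    by_cases h0 : T.singularValues i = 0
    · have hker : b i ∈ LinearMap.ker T := by
        have h2 : ‖T (b i)‖ ^ 2 = 0 := by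
          rw [← real_inner_self_eq_norm_sq, ← LinearMap.adjoint_inner_right,
            ← LinearMap.comp_apply, happ i, h0]
          simp
        simpa using h2
      have : inner ℝ (b i) w = (0 : ℝ) := hw _ hker
      simp [this]
    · have := hJ i h0
      gcongr
  exact le_of_sq_le_sq hsq (norm_nonneg _)

/-- The natural factor is `κ⁻¹`. For `w ≠ 0` the two bounds on `‖J w‖` force `κ ≤ K`, so `κ⁻¹ ≤ K
κ⁻²`, which is the form used in the explicit constants. -/
lemma NonzeroSingularValuesGE.norm_le {κ K : ℝ} (hκ : 0 < κ) {J : Vec n →L[ℝ] Vec m}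
    (hJ : NonzeroSingularValuesGE κ J) (hK : ‖J‖ ≤ K) {w : Vec n}
    (hw : w ∈ (LinearMap.ker J.toLinearMap)ᗮ) : ‖w‖ ≤ K * (κ ^ 2)⁻¹ * ‖J w‖ := by
  rcases eq_or_ne w 0 with rfl | h0
  · simp
  have h1 := hJ.mul_norm_le hκ.le hw
  have hpos : 0 < ‖w‖ := norm_pos_iff.2 h0
  have h2 : ‖J w‖ ≤ K * ‖w‖ := (J.le_opNorm w).trans (by gcongr)
  have h3 : κ ≤ K := le_of_mul_le_mul_right (h1.trans h2) hpos
  have h4 : ‖w‖ = κ * (κ ^ 2)⁻¹ * (κ * ‖w‖) := by field_simp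
  rw [h4]
  have : 0 ≤ K := hκ.le.trans h3
  gcongr

lemma exists_ker_add_orthogonal (J : Vec n →L[ℝ] Vec m) (x : Vec n) :
    ∃ y z, J y = 0 ∧ z ∈ (LinearMap.ker J.toLinearMap)ᗮ ∧ x = y + z ∧ ‖y‖ ≤ ‖x‖ ∧ ‖z‖ ≤ ‖x‖ := by
  set N := LinearMap.ker J.toLinearMap
  refine ⟨N.starProjection x, Nᗮ.starProjection x, ?_, ?_, ?_, ?_, ?_⟩
  · exact LinearMap.mem_ker.1 (N.starProjection_apply_mem x)
  · exact Nᗮ.starProjection_apply_mem x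
  · exact (N.starProjection_add_starProjection_orthogonal x).symm
  · exact N.norm_starProjection_apply_le x
  · exact Nᗮ.norm_starProjection_apply_le x

/-- If `J` has a nontrivial kernel and all its singular values are at least `κ > 0`, then `Jᵀ`
expands lengths by at least `κ`. -/
lemma SingularValuesGE.mul_norm_le_norm_tr {κ : ℝ} (hκ : 0 < κ) {J : Vec n →L[ℝ] Vec m}
    (hJ : SingularValuesGE κ J) (hker : LinearMap.ker J.toLinearMap ≠ ⊥) (c : Vec m) :
    κ * ‖c‖ ≤ ‖tr J c‖ := by
  set T := J.toLinearMap with hT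
  have hrank : ∀ i < min n m, i < Module.finrank ℝ (LinearMap.range T) := fun i hi =>
    T.singularValues_pos_iff_lt_finrank_range.1 (hκ.trans_le (hJ i hi))
  -- If `n ≤ m`, all `n` singular values would be positive and `J` injective, against the nontrivial
  -- kernel. Hence `m < n`, and `m` positive singular values make `J` surjective.
  have hmn : m < n := by
    by_contra! h
    rw [min_eq_left h] at hrank
    have hle : n ≤ Module.finrank ℝ (LinearMap.range T) := by
      by_contra! h'
      exact lt_irrefl _ (hrank _ h')
    have h2 := T.finrank_range_add_finrank_ker
    rw [finrank_euclideanSpace_fin] at h2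
    exact hker (Submodule.finrank_eq_zero.1 (by omega))
  rw [min_eq_right hmn.le] at hrank
  have hsurj : LinearMap.range T = ⊤ := by
    apply Submodule.eq_top_of_finrank_eq
    rw [finrank_euclideanSpace_fin]
    refine le_antisymm ?_ ?_
    · simpa using Submodule.finrank_le (LinearMap.range T)
    · by_contra! h'
      exact lt_irrefl _ (hrank _ h')
  have hnz : NonzeroSingularValuesGE κ J := by
    intro i hi
    apply hJ
    have := T.singularValues_pos_iff_lt_finrank_range.1 ((T.singularValues_pos_iff_ne_zero i).2 hi)
    rw [hsurj, finrank_top, finrank_euclideanSpace_fin] at this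
    omega
  obtain ⟨x, hx⟩ := LinearMap.range_eq_top.1 hsurj c
  obtain ⟨y, z, hy, hz, rfl, -, -⟩ := exists_ker_add_orthogonal J x
  have hJz : J z = c := by
    rw [← hx, hT]
    simp [hy]
  have h1 := hnz.mul_norm_le hκ.le hz
  rw [hJz] at h1
  -- With `z` the preimage of `c` orthogonal to the kernel, `‖c‖² = ⟨Jᵀc, z⟩`, and `‖z‖ ≤ ‖c‖ / κ`
  -- finishes the argument.
  have h2 : ‖c‖ ^ 2 ≤ ‖tr J c‖ * ‖z‖ := by
    calc ‖c‖ ^ 2 = inner ℝ (tr J c) z := by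
          rw [ContinuousLinearMap.adjoint_inner_left, hJz, real_inner_self_eq_norm_sq]
      _ ≤ _ := real_inner_le_norm _ _
  rcases (norm_nonneg c).eq_or_lt with h0 | h0
  · simp [← h0]
  have h3 : κ * ‖c‖ * ‖c‖ ≤ ‖tr J c‖ * ‖c‖ := by
    calc κ * ‖c‖ * ‖c‖ = κ * ‖c‖ ^ 2 := by ring
      _ ≤ κ * (‖tr J c‖ * ‖z‖) := by gcongr
      _ = ‖tr J c‖ * (κ * ‖z‖) := by ring
      _ ≤ _ := by gcongr
  exact le_of_mul_le_mul_right h3 h0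

lemma norm_tr (J : Vec n →L[ℝ] Vec m) : ‖tr J‖ = ‖J‖ :=
  LinearIsometryEquiv.norm_map ContinuousLinearMap.adjoint J

/-- Decrease of the linearized constraint violation achieved by a normal step. -/
lemma IsNormalStep.decrease {σ γ K : ℝ} (hσ : 0 < σ) (hγ : 0 < γ) (hK : 0 < K)
    {J : Vec n →L[ℝ] Vec m} {c : Vec m} {v : Vec n} (hv : IsNormalStep σ γ J c v) (hJ : ‖J‖ ≤ K) :
    1 / 2 * γ * min σ (1 / K ^ 2) * ‖tr J c‖ ^ 2 ≤ (‖c‖ - ‖c + J v‖) * ‖c‖ := by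
  set w := tr J c with hw
  set a := cauchyLength σ J c with ha
  have hcau := hv.cauchy
  rw [← hw, ← ha] at hcau
  set e := c + a • J (-w) with he
  have hJw : ‖J w‖ ≤ K * ‖w‖ := (J.le_opNorm w).trans (by gcongr)
  have ha0 : 0 ≤ a := le_min hσ.le (by positivity)
  -- The second entry of the minimum in `a` keeps the quadratic term `a² ‖J w‖²` below `a ‖w‖²`, so
  -- half of the linear gain `2 a ‖w‖²` survives.
  have haJ : a * ‖J w‖ ^ 2 ≤ ‖w‖ ^ 2 := by
    rcases (sq_nonneg ‖J w‖).eq_or_lt with h | h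
    · rw [← h]; simp
    · calc a * ‖J w‖ ^ 2 ≤ (‖w‖ ^ 2 / ‖J w‖ ^ 2) * ‖J w‖ ^ 2 := by
            gcongr; exact min_le_right _ _
        _ = _ := div_mul_cancel₀ _ h.ne'
  have hin : inner ℝ c (J w) = ‖w‖ ^ 2 := by
    rw [← ContinuousLinearMap.adjoint_inner_left, real_inner_self_eq_norm_sq]
  have hesq : ‖e‖ ^ 2 ≤ ‖c‖ ^ 2 - a * ‖w‖ ^ 2 := by
    have : e = c - a • J w := by rw [he, map_neg, smul_neg, sub_eq_add_neg]
    rw [this, norm_sub_sq_real, real_inner_smul_right, hin, norm_smul, Real.norm_eq_abs,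
      abs_of_nonneg ha0]
    nlinarith
  have hele : ‖e‖ ≤ ‖c‖ := by
    apply le_of_sq_le_sq _ (norm_nonneg _)
    nlinarith [mul_nonneg ha0 (sq_nonneg ‖w‖)]
  have hdec : 1 / 2 * (a * ‖w‖ ^ 2) ≤ (‖c‖ - ‖e‖) * ‖c‖ := by
    nlinarith [mul_nonneg (sub_nonneg.2 hele) (sub_nonneg.2 hele)]
  have hmin : min σ (1 / K ^ 2) * ‖w‖ ^ 2 ≤ a * ‖w‖ ^ 2 := by
    rcases eq_or_ne w 0 with h0 | h0
    · simp [h0]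
    have hw0 : 0 < ‖w‖ := norm_pos_iff.2 h0
    -- Needed because for `J w = 0` the quotient inside `a` would take the default value `0`. It
    -- cannot occur, as `⟨c, J w⟩ = ‖w‖² > 0`.
    have hJw0 : 0 < ‖J w‖ := by
      rw [norm_pos_iff]
      intro h
      rw [h, inner_zero_right] at hin
      nlinarith
    gcongr
    refine le_min (min_le_left _ _) ((min_le_right _ _).trans ?_)
    rw [div_le_div_iff₀ (by positivity) (by positivity), ← mul_pow, one_mul, mul_comm]
    gcongr
  calc 1 / 2 * γ * min σ (1 / K ^ 2) * ‖w‖ ^ 2 = γ * (1 / 2 * (min σ (1 / K ^ 2) * ‖w‖ ^ 2)) := by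
        ring
    _ ≤ γ * ((‖c‖ - ‖e‖) * ‖c‖) := by
        exact mul_le_mul_of_nonneg_left (by linarith) hγ.le
    _ = (γ * (‖c‖ - ‖e‖)) * ‖c‖ := by ring
    _ ≤ _ := by gcongr

end LinearAlgebra

/-- The first-order Taylor estimate for a function with Lipschitz continuous derivative. -/
lemma norm_taylor_le {E F : Type*} [NormedAddCommGroup E] [NormedSpace ℝ E] [NormedAddCommGroup F]
    [NormedSpace ℝ F] {g : E → F} {X : Set E} (hX : IsOpen X) (hc : Convex ℝ X)
    (hg : DifferentiableOn ℝ g X) {C : ℝ}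
    (hL : ∀ x ∈ X, ∀ y ∈ X, ‖fderiv ℝ g x - fderiv ℝ g y‖ ≤ C * ‖x - y‖) {x d : E} (hx : x ∈ X)
    (hd : x + d ∈ X) : ‖g (x + d) - g x - fderiv ℝ g x d‖ ≤ C / 2 * ‖d‖ ^ 2 := by
  have hmem : ∀ t ∈ Set.Icc (0 : ℝ) 1, x + t • d ∈ X := fun t ht => by
    simpa using hc.add_smul_mem hx hd ht
  set ψ : ℝ → F := fun t => g (x + t • d) - g x - t • fderiv ℝ g x d with hψ
  have hder : ∀ t ∈ Set.Icc (0 : ℝ) 1,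
      HasDerivAt ψ (fderiv ℝ g (x + t • d) d - fderiv ℝ g x d) t := by
    intro t ht
    have h1 : HasDerivAt (fun t : ℝ => x + t • d) d t := by
      simpa using ((hasDerivAt_id t).smul_const d).const_add x
    have h2 := (((hg _ (hmem t ht)).differentiableAt
      (hX.mem_nhds (hmem t ht))).hasFDerivAt).comp_hasDerivAt t h1
    have h3 : HasDerivAt (fun t : ℝ => t • fderiv ℝ g x d) (fderiv ℝ g x d) t := by
      simpa using (hasDerivAt_id t).smul_const (fderiv ℝ g x d)
    exact (h2.sub_const (g x)).sub h3
  have hB : ∀ t : ℝ, HasDerivAt (fun t : ℝ => C / 2 * ‖d‖ ^ 2 * t ^ 2) (C * ‖d‖ ^ 2 * t) t := by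
    intro t
    have := ((hasDerivAt_id t).pow 2).const_mul (C / 2 * ‖d‖ ^ 2)
    convert! this using 1
    simp; ring
  have key := image_norm_le_of_norm_deriv_right_le_deriv_boundary (f := ψ) (a := 0) (b := 1)
    (fun t ht => (hder t ht).continuousAt.continuousWithinAt)
    (fun t ht => (hder t ⟨ht.1, ht.2.le⟩).hasDerivWithinAt) (B := fun t => C / 2 * ‖d‖ ^ 2 * t ^ 2)
    (by simp [hψ]) hB (fun t ht => by
      have h := hL _ (hmem t ⟨ht.1, ht.2.le⟩) _ hx
      rw [add_sub_cancel_left, norm_smul, Real.norm_eq_abs, abs_of_nonneg ht.1] at h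
      calc ‖fderiv ℝ g (x + t • d) d - fderiv ℝ g x d‖
          = ‖(fderiv ℝ g (x + t • d) - fderiv ℝ g x) d‖ := by simp
        _ ≤ ‖fderiv ℝ g (x + t • d) - fderiv ℝ g x‖ * ‖d‖ := ContinuousLinearMap.le_opNorm _ _
        _ ≤ C * (t * ‖d‖) * ‖d‖ := by gcongr
        _ = _ := by ring)
    (Set.right_mem_Icc.2 zero_le_one)
  simpa [hψ] using key

/-! ### Signs of the basic constants -/

namespace Params.ValidCommon

variable {p : Params} (hp : p.ValidCommon)
include hp

lemma KJ_pos : 0 < p.KJ := add_pos_of_pos_of_nonneg hp.κJ hp.εJ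

lemma Kc_pos : 0 < p.Kc := add_pos_of_pos_of_nonneg hp.κc hp.εc

lemma σv_pos : 0 < p.σv := by
  have := hp.KJ_pos
  have := hp.γcbar.1
  have : 0 < min p.σJc (1 / p.KJ ^ 2) := lt_min hp.σJc (by positivity)
  unfold Params.σv
  positivity

lemma σlow_pos : 0 < p.σlow := div_pos hp.σv_pos (mul_pos hp.Kc_pos hp.KJ_pos)

lemma σr_pos : 0 < p.σr := hp.σc.1.trans hp.σr.1

lemma κu_pos : 0 < p.κu := by
  have := hp.KJ_pos
  have := hp.Kc_pos
  have := hp.κσ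
  have := hp.ζ
  have := hp.κH
  have := hp.lamρr.1
  have := hp.κρr
  have := hp.κg
  have := hp.εg
  have := hp.σJc
  unfold Params.κu
  positivity

lemma EJc_nonneg : 0 ≤ p.EJc := by
  have := hp.KJ_pos
  have := hp.κc
  have := hp.εc
  have := hp.εJ
  unfold Params.EJc
  positivity

end Params.ValidCommon

/-! ### A single iteration: merit parameter, model reduction, tangential step -/

section Direction

variable {n m : ℕ} {P : NoisyProblem n m} {p : Params} {R : Iterates n m} {k : ℕ}

lemma lamu_mul_sq_le_curvMax : p.lamu * ‖R.ubar k‖ ^ 2 ≤ curvMax p R k := le_max_right _ _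

lemma curvMax_nonneg (hp : p.ValidCommon) : 0 ≤ curvMax p R k :=
  (mul_nonneg hp.lamu.1.le (sq_nonneg _)).trans lamu_mul_sq_le_curvMax

lemma Δk_eq : Δk P R k = -R.τ k * inner ℝ (gk P R k) (dk R k) + fullRed P R k := by
  unfold Δk modelRed fullRed gk ck rk Jk dk
  rw [map_add, ← add_assoc]
  ring

lemma tr_ck_le {K : ℝ} (hJ : ‖Jk P R k‖ ≤ K) : ‖JTck P R k‖ ≤ K * ‖ck P R k‖ := by
  refine (ContinuousLinearMap.le_opNorm _ _).trans ?_
  rw [norm_tr]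
  gcongr

lemma Direction.resid (hd : Direction P p R k) : ResidualSmall P p R k := by
  rcases le_or_gt ‖ck P R k‖ p.εo with h | h
  · exact (hd.small h).2.2.1.resid
  · exact (hd.large h).2.2.1.resid

lemma Direction.norm_vbar_le (hp : p.ValidCommon) (hd : Direction P p R k) :
    ‖R.vbar k‖ ≤ p.σJc * ‖JTck P R k‖ := by
  rcases le_or_gt ‖ck P R k‖ p.εo with h | h
  · rw [(hd.small h).1, norm_zero]
    exact mul_nonneg hp.σJc.le (norm_nonneg _)
  · exact (hd.large h).2.1.norm_le

/-- The trial value is adopted only when the model condition fails. Then `FeasCond` makes `fullRed`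
positive, `τden` is positive, and `σc < σr`, so the trial value is positive. -/
lemma Direction.τ_pos_le (hp : p.ValidCommon) (hd : Direction P p R k)
    (hτ : 0 < τprev p R k) : 0 < R.τ k ∧ R.τ k ≤ τprev p R k := by
  rcases le_or_gt ‖ck P R k‖ p.εo with h | h
  · rw [(hd.small h).2.1]
    exact ⟨hτ, le_rfl⟩
  obtain ⟨-, -, ht, h4⟩ := hd.large h
  rw [h4, τnext]
  split_ifs with h1 h2 h3
  · exact ⟨hτ, le_rfl⟩
  · exact ⟨hτ, le_rfl⟩
  · exact ⟨hτ, le_rfl⟩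
  · obtain ⟨hf1, hf2⟩ := ht.either.resolve_left h1
    push Not at h2 h3
    refine ⟨mul_pos (by linarith [hp.στ.2]) (div_pos (mul_pos ?_ (by linarith)) h2), h3.le⟩
    rw [sub_pos, div_lt_one hp.σr_pos]
    exact hp.σr.1

/-- Either the model condition held for the old parameter, which is then kept, or the update
enforces `τ τden ≤ (1 - σc/σr) fullRed`. In the latter case a fraction `σc/σr` of `fullRed` is left
over, and `FeasCond` turns it into `σc normalRed`. -/
lemma Direction.le_Δk_of_large (hp : p.ValidCommon) (hd : Direction P p R k)
    (hτ : 0 < τprev p R k) (h : p.εo < ‖ck P R k‖) :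
    R.τ k * p.σu * curvMax p R k + p.σc * normalRed P R k ≤ Δk P R k := by
  have hpos := (hd.τ_pos_le hp hτ).1
  obtain ⟨-, -, ht, h4⟩ := hd.large h
  by_cases h1 : ModelCond P p R k
  · have h5 : R.τ k = τprev p R k := by rw [h4, τnext, if_pos h1]
    rw [Δk, h5]
    exact h1
  obtain ⟨hf1, hf2⟩ := ht.either.resolve_left h1
  have hM := curvMax_nonneg (R := R) (k := k) hp
  have hσr := hp.σr_pos
  have hred : 0 < normalRed P R k := pos_of_mul_pos_right hf2 hσr.le
  have hfull : 0 < fullRed P R k := hf2.trans_le hf1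
  -- An infinite trial value corresponds to `τden ≤ 0`, where the bound is a matter of signs; in
  -- both finite branches `τ ≤ (1 - στ) τtrial`.
  have h6 : R.τ k * τden P p R k ≤ (1 - p.σc / p.σr) * fullRed P R k := by
    have hc : 0 < 1 - p.σc / p.σr := by
      rw [sub_pos, div_lt_one hσr]
      exact hp.σr.1
    rcases le_or_gt (τden P p R k) 0 with h2 | h2
    · exact (mul_nonpos_of_nonneg_of_nonpos hpos.le h2).trans (by positivity)
    · have h7 : R.τ k ≤ (1 - p.στ) * τtrial P p R k := by
        rw [h4, τnext, if_neg h1, if_neg (not_le.2 h2)]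
        split_ifs with h3
        · exact h3
        · exact le_rfl
      have h8 : τtrial P p R k * τden P p R k = (1 - p.σc / p.σr) * fullRed P R k :=
        div_mul_cancel₀ _ h2.ne'
      have h9 : 0 ≤ (1 - p.σc / p.σr) * fullRed P R k := by positivity
      calc R.τ k * τden P p R k ≤ (1 - p.στ) * τtrial P p R k * τden P p R k := by gcongr
        _ = (1 - p.στ) * ((1 - p.σc / p.σr) * fullRed P R k) := by rw [mul_assoc, h8]
        _ ≤ _ := by nlinarith [hp.στ.1]
  have h10 : p.σc * normalRed P R k ≤ p.σc / p.σr * fullRed P R k := by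
    calc p.σc * normalRed P R k = p.σc / p.σr * (p.σr * normalRed P R k) := by field_simp
      _ ≤ _ := by
        have := hp.σc.1
        gcongr
  have h11 : R.τ k * p.σu * curvMax p R k ≤ R.τ k * curvMax p R k := by
    have := mul_nonneg hpos.le hM
    nlinarith [hp.σu.2]
  rw [Δk_eq]
  unfold τden at h6
  linarith

/-- The test allows a slack `εo`, and `εo < Δk` because the method did not stop; this is the origin
of the factor `2`. -/
lemma Direction.le_Δk_of_small (hd : Direction P p R k) (h : ‖ck P R k‖ ≤ p.εo) :
    R.τ k * p.σu * curvMax p R k ≤ 2 * Δk P R k := by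
  obtain ⟨hv, hτ, ht, hlt⟩ := hd.small h
  have hm := ht.model
  have : Δk P R k = modelRed P (R.x k) (τprev p R k) (R.ubar k) := by
    rw [Δk, dk, hv, zero_add, hτ]
  rw [hτ]
  linarith

lemma Direction.normalRed_ge (hp : p.ValidCommon) (hd : Direction P p R k)
    (h : p.εo < ‖ck P R k‖) (hJ : ‖Jk P R k‖ ≤ p.KJ) :
    p.σv * ‖JTck P R k‖ ^ 2 ≤ normalRed P R k * ‖ck P R k‖ :=
  (hd.large h).2.1.decrease hp.σJc hp.γcbar.1 hp.KJ_pos hJ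

lemma Direction.normalRed_pos (hp : p.ValidCommon) (hd : Direction P p R k)
    (h : p.εo < ‖ck P R k‖) (hJ : ‖Jk P R k‖ ≤ p.KJ) : 0 < normalRed P R k := by
  have h1 := hd.normalRed_ge hp h hJ
  have h2 : 0 < ‖JTck P R k‖ := norm_pos_iff.2 (hd.large h).1
  have h3 := hp.σv_pos
  exact pos_of_mul_pos_left ((by positivity : (0 : ℝ) < _).trans_le h1) (norm_nonneg _)

lemma Direction.normalRed_ge' (hp : p.ValidCommon) (hd : Direction P p R k)
    (h : p.εo < ‖ck P R k‖) (hJ : ‖Jk P R k‖ ≤ p.KJ) (hc : ‖ck P R k‖ ≤ p.Kc) :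
    p.σv * ‖JTck P R k‖ ^ 2 / p.Kc ≤ normalRed P R k := by
  have h1 := hd.normalRed_ge hp h hJ
  rw [div_le_iff₀ hp.Kc_pos]
  exact h1.trans (mul_le_mul_of_nonneg_left hc (hd.normalRed_pos hp h hJ).le)

lemma Direction.Δk_pos (hp : p.ValidCommon) (hd : Direction P p R k)
    (hτ : 0 < τprev p R k) (hJ : ‖Jk P R k‖ ≤ p.KJ) : 0 < Δk P R k := by
  rcases le_or_gt ‖ck P R k‖ p.εo with h | h
  · exact hp.εo.1.trans_lt (hd.small h).2.2.2
  · have h1 := hd.le_Δk_of_large hp hτ h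
    have h2 := hd.normalRed_pos hp h hJ
    have h3 := (hd.τ_pos_le hp hτ).1
    have h4 := curvMax_nonneg (R := R) (k := k) hp
    have h5 := hp.σu.1
    have h6 := hp.σc.1
    exact (by positivity : (0 : ℝ) < _).trans_le h1

lemma dk_ne_zero (h : 0 < Δk P R k) : dk R k ≠ 0 := by
  intro h0
  rw [Δk, h0] at h
  simp [modelRed] at h

/-- The bound on the tangential steps that follows from small residuals. -/
lemma norm_ubar_le (hp : p.ValidCommon) (hres : ResidualSmall P p R k)
    (hH : ‖R.H k‖ ≤ p.κH)
    (hcurv : ∀ u, Jk P R k u = 0 → p.ζ * ‖u‖ ^ 2 ≤ inner ℝ u (R.H k u))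
    (hsv : NonzeroSingularValuesGE p.κσ (Jk P R k)) (hJ : ‖Jk P R k‖ ≤ p.KJ)
    (hg : ‖gk P R k‖ ≤ p.κg + p.εg) (hv : ‖R.vbar k‖ ≤ p.σJc * p.KJ * p.Kc) :
    ‖R.ubar k‖ ≤ p.κu := by
  have hζ := hp.ζ
  have hKJ := hp.KJ_pos
  have hκH := hp.κH
  have hres' : max ‖ρk P R k‖ ‖rk P R k‖ ≤ p.lamρr * p.κρr :=
    hres.trans (mul_le_mul_of_nonneg_left (min_le_right _ _) hp.lamρr.1.le)
  have hρ := (le_max_left _ _).trans hres'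
  have hr := (le_max_right _ _).trans hres'
  -- The part `z` orthogonal to the kernel is controlled by the primal residual `J̄ z`, the kernel
  -- part `y` by the curvature of `H` and the dual residual.
  obtain ⟨y, z, hy, hz, hyz, -, -⟩ := exists_ker_add_orthogonal (Jk P R k) (R.ubar k)
  have hrz : rk P R k = Jk P R k z := by rw [rk, hyz, map_add, hy, zero_add]
  have hz1 : ‖z‖ ≤ p.KJ * (p.κσ ^ 2)⁻¹ * (p.lamρr * p.κρr) := by
    refine (hsv.norm_le hp.κσ hJ hz).trans ?_
    rw [← hrz]
    gcongr
  -- Pairing the dual residual with `y` eliminates the multiplier, since `J̄ y = 0`.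
  have hin : inner ℝ y (ρk P R k) = inner ℝ y (R.H k y) + inner ℝ y (R.H k z)
      + inner ℝ y (gk P R k) + inner ℝ y (R.H k (R.vbar k)) := by
    rw [ρk, inner_add_right, inner_add_right, inner_add_right,
      ContinuousLinearMap.adjoint_inner_right, hy, inner_zero_left, hyz, map_add, inner_add_right]
    ring
  have b1 : inner ℝ y (ρk P R k) ≤ ‖y‖ * (p.lamρr * p.κρr) :=
    (real_inner_le_norm _ _).trans (by gcongr)
  have b2 : -inner ℝ y (R.H k z) ≤ ‖y‖ * (p.κH * ‖z‖) :=
    (neg_le_abs _).trans ((abs_real_inner_le_norm _ _).trans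
      (by gcongr; exact (R.H k).le_of_opNorm_le hH z))
  have b3 : -inner ℝ y (gk P R k) ≤ ‖y‖ * (p.κg + p.εg) :=
    (neg_le_abs _).trans ((abs_real_inner_le_norm _ _).trans (by gcongr))
  have b4 : -inner ℝ y (R.H k (R.vbar k)) ≤ ‖y‖ * (p.κH * (p.σJc * p.KJ * p.Kc)) :=
    (neg_le_abs _).trans ((abs_real_inner_le_norm _ _).trans
      (by gcongr; exact ((R.H k).le_of_opNorm_le hH _).trans (by gcongr)))
  have hyc := hcurv y hy
  have hy1 : p.ζ * ‖y‖ ≤ p.lamρr * p.κρr + p.κH * ‖z‖ + (p.κg + p.εg)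
      + p.κH * (p.σJc * p.KJ * p.Kc) := by
    rcases (norm_nonneg y).eq_or_lt with h0 | h0
    · rw [← h0, mul_zero]
      have := hp.lamρr.1
      have := hp.κρr
      have := hp.κg
      have := hp.εg
      have := hp.σJc
      have := hp.Kc_pos
      positivity
    · refine le_of_mul_le_mul_right ?_ h0
      nlinarith
  have hy2 : ‖y‖ ≤ p.ζ⁻¹ * (p.lamρr * p.κρr + p.κH * ‖z‖ + (p.κg + p.εg)
      + p.κH * (p.σJc * p.KJ * p.Kc)) := by
    rw [inv_mul_eq_div, le_div_iff₀ hζ, mul_comm]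
    exact hy1
  calc ‖R.ubar k‖ ≤ ‖y‖ + ‖z‖ := by rw [hyz]; exact norm_add_le _ _
    _ ≤ p.ζ⁻¹ * (p.lamρr * p.κρr + p.κH * ‖z‖ + (p.κg + p.εg)
        + p.κH * (p.σJc * p.KJ * p.Kc)) + ‖z‖ := by gcongr
    _ = (1 + p.ζ⁻¹ * p.κH) * ‖z‖ + p.ζ⁻¹ * (p.lamρr * p.κρr)
        + p.ζ⁻¹ * (p.κg + p.εg + p.κH * p.σJc * p.KJ * p.Kc) := by ring
    _ ≤ (1 + p.ζ⁻¹ * p.κH) * (p.KJ * (p.κσ ^ 2)⁻¹ * (p.lamρr * p.κρr))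
        + p.ζ⁻¹ * (p.lamρr * p.κρr)
        + p.ζ⁻¹ * (p.κg + p.εg + p.κH * p.σJc * p.KJ * p.Kc) := by gcongr
    _ = p.κu := by unfold Params.κu; ring

end Direction

/-! ### Effect of the noise on the data and on the merit function -/

namespace Regular

variable {n m : ℕ} {P : NoisyProblem n m} {p : Params} {X : Set (Vec n)} (hP : Regular P p X)
  {x : Vec n} (hx : x ∈ X)
include hP hx

lemma norm_Jbar_le : ‖P.Jbar x‖ ≤ p.KJ := by
  have h := norm_add_le (P.J x) (P.Jbar x - P.J x)
  rw [add_sub_cancel] at h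
  exact h.trans (add_le_add (hP.J_bound x hx) (hP.noise_J x hx))

lemma norm_cbar_le : ‖P.cbar x‖ ≤ p.Kc := by
  have h := norm_add_le (P.c x) (P.cbar x - P.c x)
  rw [add_sub_cancel] at h
  exact h.trans (add_le_add (hP.c_bound x hx) (hP.noise_c x hx))

lemma norm_gbar_le : ‖P.gbar x‖ ≤ p.κg + p.εg := by
  have h := norm_add_le (gradient P.f x) (P.gbar x - gradient P.f x)
  rw [add_sub_cancel] at h
  exact h.trans (add_le_add (hP.g_bound x hx) (hP.noise_g x hx))

/-- Upper bound for the change of the merit function along a step `a • d`. -/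
lemma merit_le {τ a : ℝ} {d : Vec n} (hτ : 0 ≤ τ) (ha0 : 0 ≤ a) (ha1 : a ≤ 1)
    (hd : x + a • d ∈ X) :
    merit P (x + a • d) τ ≤ merit P x τ - a * modelRed P x τ d
      + 1 / 2 * (τ * p.L + p.Γ) * a ^ 2 * ‖d‖ ^ 2 + a * τ * p.εg * ‖d‖ + 2 * p.εc
      + a * p.εJ * ‖d‖ := by
  have hf := norm_taylor_le hP.isOpen hP.convex hP.f_diff (C := p.L) (fun y hy z hz => by
    have h := hP.g_lip y hy z hz
    rwa [gradient, gradient, ← map_sub, LinearIsometryEquiv.norm_map] at h) hx hd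
  have hc := norm_taylor_le hP.isOpen hP.convex hP.c_diff (C := p.Γ)
    (fun y hy z hz => hP.J_lip y hy z hz) hx hd
  have hnorm : ‖a • d‖ ^ 2 = a ^ 2 * ‖d‖ ^ 2 := by
    rw [norm_smul, Real.norm_eq_abs, mul_pow, sq_abs]
  rw [hnorm] at hf hc
  have hfd : fderiv ℝ P.f x (a • d) = a * inner ℝ (gradient P.f x) d := by
    rw [map_smul, smul_eq_mul, inner_gradient_left]
  rw [hfd] at hf
  have hf1 := (le_abs_self _).trans hf
  have hg : a * inner ℝ (gradient P.f x) d ≤ a * (inner ℝ (P.gbar x) d + p.εg * ‖d‖) := by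
    gcongr
    have h1 := (neg_le_abs _).trans (abs_real_inner_le_norm (P.gbar x - gradient P.f x) d)
    rw [inner_sub_left] at h1
    have h2 := mul_le_mul_of_nonneg_right (hP.noise_g x hx) (norm_nonneg d)
    linarith
  have hc1 : ‖P.c (x + a • d)‖ ≤ p.Γ / 2 * (a ^ 2 * ‖d‖ ^ 2) + ‖P.c x + a • P.J x d‖ := by
    have h1 := norm_add_le (P.c (x + a • d) - P.c x - fderiv ℝ P.c x (a • d))
      (P.c x + a • P.J x d)
    have h2 : P.c (x + a • d) - P.c x - fderiv ℝ P.c x (a • d) + (P.c x + a • P.J x d)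
        = P.c (x + a • d) := by
      rw [NoisyProblem.J, map_smul]; abel
    rw [h2] at h1
    linarith
  -- Passing to the noisy linearization costs one `εc`; returning from `‖c̄‖` to `‖c‖` in `hc4`
  -- costs the second.
  have hc2 : ‖P.c x + a • P.J x d‖ ≤ ‖P.cbar x + a • P.Jbar x d‖ + p.εc + a * (p.εJ * ‖d‖) := by
    have h1 : P.c x + a • P.J x d = (P.cbar x + a • P.Jbar x d) - (P.cbar x - P.c x)
        - a • ((P.Jbar x - P.J x) d) := by
      rw [sub_apply, smul_sub]; abel
    have h2 : ‖a • ((P.Jbar x - P.J x) d)‖ ≤ a * (p.εJ * ‖d‖) := by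
      rw [norm_smul, Real.norm_eq_abs, abs_of_nonneg ha0]
      gcongr
      exact ContinuousLinearMap.le_of_opNorm_le _ (hP.noise_J x hx) d
    rw [h1]
    refine (norm_sub_le _ _).trans (add_le_add ((norm_sub_le _ _).trans ?_) h2)
    gcongr
    exact hP.noise_c x hx
  -- Convexity of the norm, for which `a ≤ 1` is needed: a step of length `a` gains the fraction `a`
  -- of the model reduction.
  have hc3 : ‖P.cbar x + a • P.Jbar x d‖
      ≤ (1 - a) * ‖P.cbar x‖ + a * ‖P.cbar x + P.Jbar x d‖ := by
    have h1 : P.cbar x + a • P.Jbar x d = (1 - a) • P.cbar x + a • (P.cbar x + P.Jbar x d) := by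
      rw [smul_add, sub_smul, one_smul]; abel
    rw [h1]
    refine (norm_add_le _ _).trans (le_of_eq ?_)
    rw [norm_smul, norm_smul, Real.norm_eq_abs, Real.norm_eq_abs, abs_of_nonneg ha0,
      abs_of_nonneg (sub_nonneg.2 ha1)]
  have hc4 : ‖P.cbar x‖ ≤ ‖P.c x‖ + p.εc := by
    have h := norm_add_le (P.c x) (P.cbar x - P.c x)
    rw [add_sub_cancel] at h
    exact h.trans (add_le_add le_rfl (hP.noise_c x hx))
  have hff : P.f (x + a • d) ≤ P.f x + a * (inner ℝ (P.gbar x) d + p.εg * ‖d‖)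
      + p.L / 2 * (a ^ 2 * ‖d‖ ^ 2) := by linarith
  have hff' := mul_le_mul_of_nonneg_left hff hτ
  unfold merit modelRed
  linarith

lemma merit_le_noisyMerit {τ : ℝ} (hτ : 0 ≤ τ) : merit P x τ ≤ noisyMerit P x τ
    + τ * p.εf + p.εc := by
  have h1 := mul_le_mul_of_nonneg_left ((neg_le_abs _).trans (hP.noise_f x hx)) hτ
  have h := norm_sub_le (P.cbar x) (P.cbar x - P.c x)
  rw [sub_sub_cancel] at h
  have := hP.noise_c x hx
  unfold merit noisyMerit
  linarith

lemma noisyMerit_le_merit {τ : ℝ} (hτ : 0 ≤ τ) : noisyMerit P x τ ≤ merit P x τ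
    + τ * p.εf + p.εc := by
  have h1 := mul_le_mul_of_nonneg_left ((le_abs_self _).trans (hP.noise_f x hx)) hτ
  have h := norm_add_le (P.c x) (P.cbar x - P.c x)
  rw [add_sub_cancel] at h
  have := hP.noise_c x hx
  unfold merit noisyMerit
  linarith

end Regular

lemma Params.Valid.common {p : Params} {rule : StepRule} (hp : p.Valid rule) : p.ValidCommon := by
  cases rule <;> exact hp.1

/-! ### Bounds that hold along a whole run -/

section Run

variable {n m : ℕ} {P : NoisyProblem n m} {p : Params} {rule : StepRule} {X : Set (Vec n)}
  {R : Iterates n m}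

namespace IsRun

section Basic

variable (hR : IsRun P p rule X R) (hp : p.ValidCommon)
include hR hp

lemma τprev_pos (k : ℕ) : 0 < τprev p R k := by
  induction k with
  | zero => exact hp.τ0
  | succ k ih => exact ((hR.direction k).τ_pos_le hp ih).1

lemma τ_pos (k : ℕ) : 0 < R.τ k := hR.τprev_pos hp (k + 1)

lemma τ_succ_le (k : ℕ) : R.τ (k + 1) ≤ R.τ k :=
  ((hR.direction (k + 1)).τ_pos_le hp (hR.τprev_pos hp (k + 1))).2

lemma τ_le (k : ℕ) : R.τ k ≤ p.τ0 := by
  induction k with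
  | zero => exact ((hR.direction 0).τ_pos_le hp (hR.τprev_pos hp 0)).2
  | succ k ih => exact (hR.τ_succ_le hp k).trans ih

lemma lipschitz_pos (k : ℕ) : 0 < R.τ k * p.L + p.Γ :=
  add_pos_of_pos_of_nonneg (mul_pos (hR.τ_pos hp k) hp.L) hp.Γ

lemma lipschitz_le (k : ℕ) : R.τ k * p.L + p.Γ ≤ p.τ0 * p.L + p.Γ := by
  have := hR.τ_le hp k
  have := hp.L
  gcongr

omit hp in
lemma norm_Jk_le (hP : Regular P p X) (k : ℕ) : ‖Jk P R k‖ ≤ p.KJ := hP.norm_Jbar_le (hR.x_mem k)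

omit hp in
lemma norm_ck_le (hP : Regular P p X) (k : ℕ) : ‖ck P R k‖ ≤ p.Kc := hP.norm_cbar_le (hR.x_mem k)

lemma norm_JTck_le (hP : Regular P p X) (k : ℕ) : ‖JTck P R k‖ ≤ p.KJ * p.Kc :=
  (tr_ck_le (hR.norm_Jk_le hP k)).trans
    (mul_le_mul_of_nonneg_left (hR.norm_ck_le hP k) hp.KJ_pos.le)

lemma norm_vbar_le (hP : Regular P p X) (k : ℕ) : ‖R.vbar k‖ ≤ p.σJc * p.KJ * p.Kc := by
  refine ((hR.direction k).norm_vbar_le hp).trans ?_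
  rw [mul_assoc]
  exact mul_le_mul_of_nonneg_left (hR.norm_JTck_le hp hP k) hp.σJc.le

lemma norm_ubar_le (hP : Regular P p X) (k : ℕ) : ‖R.ubar k‖ ≤ p.κu :=
  NoisySQP.norm_ubar_le hp (hR.direction k).resid (hR.H_bound k)
    (fun u hu => hR.H_curv k u (Or.inr hu)) (hR.sv_Jbar k) (hR.norm_Jk_le hP k)
    (hP.norm_gbar_le (hR.x_mem k)) (hR.norm_vbar_le hp hP k)

lemma norm_dk_le (hP : Regular P p X) (k : ℕ) : ‖dk R k‖ ≤ p.κd := by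
  refine (norm_add_le _ _).trans ?_
  rw [add_comm]
  exact add_le_add (hR.norm_ubar_le hp hP k) (hR.norm_vbar_le hp hP k)

lemma Δk_pos (hP : Regular P p X) (k : ℕ) : 0 < Δk P R k :=
  (hR.direction k).Δk_pos hp (hR.τprev_pos hp k) (hR.norm_Jk_le hP k)

lemma norm_dk_pos (hP : Regular P p X) (k : ℕ) : 0 < ‖dk R k‖ :=
  norm_pos_iff.2 (dk_ne_zero (hR.Δk_pos hp hP k))

/-- Lower bound for the model reduction at iterates with a noisy constraint violation above the
optimistic feasibility parameter. -/
lemma le_Δk_of_large {k : ℕ} (h : p.εo < ‖ck P R k‖) :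
    R.τ k * p.σu * p.lamu * ‖R.ubar k‖ ^ 2 + p.σc * normalRed P R k ≤ Δk P R k := by
  have h1 := (hR.direction k).le_Δk_of_large hp (hR.τprev_pos hp k) h
  have h2 := mul_le_mul_of_nonneg_left (lamu_mul_sq_le_curvMax (p := p) (R := R) (k := k))
    (mul_pos (hR.τ_pos hp k) hp.σu.1).le
  linarith

lemma le_Δk_of_large' (hP : Regular P p X) {k : ℕ} (h : p.εo < ‖ck P R k‖) :
    R.τ k * p.σu * p.lamu * ‖R.ubar k‖ ^ 2 + p.σc * p.σv / p.Kc * ‖JTck P R k‖ ^ 2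
      ≤ Δk P R k := by
  have h1 := hR.le_Δk_of_large hp h
  have h2 := mul_le_mul_of_nonneg_left ((hR.direction k).normalRed_ge' hp h
    (hR.norm_Jk_le hP k) (hR.norm_ck_le hP k)) hp.σc.1.le
  calc _ = R.τ k * p.σu * p.lamu * ‖R.ubar k‖ ^ 2
        + p.σc * (p.σv * ‖JTck P R k‖ ^ 2 / p.Kc) := by ring
    _ ≤ _ := by linarith

lemma le_Δk_of_small {k : ℕ} (h : ‖ck P R k‖ ≤ p.εo) :
    R.τ k * p.σu * p.lamu * ‖R.ubar k‖ ^ 2 ≤ 2 * Δk P R k := by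
  have h1 := (hR.direction k).le_Δk_of_small h
  have h2 := mul_le_mul_of_nonneg_left (lamu_mul_sq_le_curvMax (p := p) (R := R) (k := k))
    (mul_pos (hR.τ_pos hp k) hp.σu.1).le
  linarith

/-- The model reduction dominates the squared tangential step in all cases. -/
lemma le_two_Δk (hP : Regular P p X) (k : ℕ) :
    R.τ k * p.σu * p.lamu * ‖R.ubar k‖ ^ 2 ≤ 2 * Δk P R k := by
  rcases le_or_gt ‖ck P R k‖ p.εo with h | h
  · exact hR.le_Δk_of_small hp h
  · have h1 := hR.le_Δk_of_large hp h
    have h2 := mul_pos hp.σc.1 ((hR.direction k).normalRed_pos hp h (hR.norm_Jk_le hP k))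
    have h3 := hR.Δk_pos hp hP k
    linarith

omit hR hp in
lemma norm_dk_sq_le (k : ℕ) : ‖dk R k‖ ^ 2 ≤ 2 * ‖R.ubar k‖ ^ 2 + 2 * ‖R.vbar k‖ ^ 2 := by
  have h : ‖dk R k‖ ≤ ‖R.vbar k‖ + ‖R.ubar k‖ := norm_add_le _ _
  calc ‖dk R k‖ ^ 2 ≤ (‖R.vbar k‖ + ‖R.ubar k‖) ^ 2 := by gcongr
    _ ≤ _ := by nlinarith [sq_nonneg (‖R.vbar k‖ - ‖R.ubar k‖)]

lemma norm_vbar_sq_le (k : ℕ) : ‖R.vbar k‖ ^ 2 ≤ p.σJc ^ 2 * ‖JTck P R k‖ ^ 2 := by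
  rw [← mul_pow]
  have := (hR.direction k).norm_vbar_le hp
  gcongr

/-- `‖d̄‖²` is at most `2 ‖ū‖² + 2 σJc² ‖J̄ᵀc̄‖²`, and `Δ` dominates both terms once `τ` is bounded
below: hence the minimum over the maximum in `κΔ`. When `‖c̄‖ ≤ εo` the normal step vanishes and the
entry `2` of the maximum pays for the slack. -/
lemma κΔ_mul_le (hP : Regular P p X) {τmin : ℝ} (hτmin : 0 < τmin) {k : ℕ} (hτ : τmin ≤ R.τ k) :
    p.κΔ τmin * ‖dk R k‖ ^ 2 ≤ Δk P R k := by
  have hσu := hp.σu.1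
  have hlamu := hp.lamu.1
  have hσc := hp.σc.1
  have hσv := hp.σv_pos
  have hKc := hp.Kc_pos
  have hA : 0 < min (τmin * p.σu * p.lamu) (p.σc * p.σv / p.Kc) :=
    lt_min (by positivity) (by positivity)
  have hτu : τmin * p.σu * p.lamu * ‖R.ubar k‖ ^ 2 ≤ R.τ k * p.σu * p.lamu * ‖R.ubar k‖ ^ 2 := by
    gcongr
  have hM : (0 : ℝ) < max 2 (2 * p.σJc ^ 2) := lt_max_of_lt_left two_pos
  rw [Params.κΔ, div_mul_eq_mul_div, div_le_iff₀ hM]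
  rcases le_or_gt ‖ck P R k‖ p.εo with h | h
  · have h1 := hR.le_Δk_of_small hp h
    have h2 : dk R k = R.ubar k := by rw [dk, ((hR.direction k).small h).1, zero_add]
    rw [h2]
    calc _ ≤ τmin * p.σu * p.lamu * ‖R.ubar k‖ ^ 2 := by gcongr; exact min_le_left _ _
      _ ≤ 2 * Δk P R k := hτu.trans h1
      _ ≤ Δk P R k * max 2 (2 * p.σJc ^ 2) := by
        rw [mul_comm]
        exact mul_le_mul_of_nonneg_left (le_max_left _ _) (hR.Δk_pos hp hP k).le
  · have h1 := hR.le_Δk_of_large' hp hP h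
    have h2 := norm_dk_sq_le (R := R) k
    have h3 := hR.norm_vbar_sq_le hp k
    set A := min (τmin * p.σu * p.lamu) (p.σc * p.σv / p.Kc)
    set M := max 2 (2 * p.σJc ^ 2)
    have h4 : ‖dk R k‖ ^ 2 ≤ M * (‖R.ubar k‖ ^ 2 + ‖JTck P R k‖ ^ 2) := by
      calc ‖dk R k‖ ^ 2 ≤ 2 * ‖R.ubar k‖ ^ 2 + 2 * p.σJc ^ 2 * ‖JTck P R k‖ ^ 2 := by linarith
        _ ≤ M * ‖R.ubar k‖ ^ 2 + M * ‖JTck P R k‖ ^ 2 := by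
          gcongr
          · exact le_max_left _ _
          · exact le_max_right _ _
        _ = _ := by ring
    calc A * ‖dk R k‖ ^ 2 ≤ A * (M * (‖R.ubar k‖ ^ 2 + ‖JTck P R k‖ ^ 2)) := by gcongr
      _ = (A * ‖R.ubar k‖ ^ 2 + A * ‖JTck P R k‖ ^ 2) * M := by ring
      _ ≤ (τmin * p.σu * p.lamu * ‖R.ubar k‖ ^ 2 + p.σc * p.σv / p.Kc * ‖JTck P R k‖ ^ 2) * M := by
        gcongr
        · exact min_le_left _ _
        · exact min_le_right _ _
      _ ≤ Δk P R k * M := by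
        gcongr
        linarith

/-- Without a lower bound on `τ` the tangential term of `Δ` is worthless. Instead `‖ū‖ ≤ κu` and
`‖v̄‖ ≥ σlow γ²` bound `‖ū‖` by a multiple of `‖v̄‖`, hence of `‖J̄ᵀc̄‖`. -/
lemma κΔ0_mul_le (hP : Regular P p X) {γ : ℝ} (hγ : 0 < γ) {k : ℕ} (h : p.εo < ‖ck P R k‖)
    (hJc : γ ≤ ‖JTck P R k‖) : p.κΔ0 γ * ‖dk R k‖ ^ 2 ≤ Δk P R k := by
  have hσc := hp.σc.1
  have hσv := hp.σv_pos
  have hKc := hp.Kc_pos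
  have hKJ := hp.KJ_pos
  have hσl := hp.σlow_pos
  have hσJ := hp.σJc
  have hκu := hp.κu_pos
  have h1 : p.σc * p.σv / p.Kc * ‖JTck P R k‖ ^ 2 ≤ Δk P R k := by
    have h2 := hR.le_Δk_of_large' hp hP h
    have h3 : 0 ≤ R.τ k * p.σu * p.lamu * ‖R.ubar k‖ ^ 2 := by
      have := hR.τ_pos hp k
      have := hp.σu.1
      have := hp.lamu.1
      positivity
    linarith
  -- A normal step that decreases `‖c̄ + J̄ v‖` cannot be short: the decrease is at most `KJ ‖v̄‖`.
  have hv : p.σlow * γ ^ 2 ≤ ‖R.vbar k‖ := by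
    have h2 := (hR.direction k).normalRed_ge' hp h (hR.norm_Jk_le hP k) (hR.norm_ck_le hP k)
    have h3 : normalRed P R k ≤ p.KJ * ‖R.vbar k‖ := by
      have h4 := norm_sub_le (ck P R k + Jk P R k (R.vbar k)) (Jk P R k (R.vbar k))
      rw [add_sub_cancel_right] at h4
      have h5 := (Jk P R k).le_of_opNorm_le (hR.norm_Jk_le hP k) (R.vbar k)
      unfold normalRed
      linarith
    have h6 : p.σv * γ ^ 2 / p.Kc ≤ p.KJ * ‖R.vbar k‖ :=
      le_trans (by gcongr) (h2.trans h3)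
    calc p.σlow * γ ^ 2 = (p.σv * γ ^ 2 / p.Kc) / p.KJ := by
          unfold Params.σlow; field_simp
      _ ≤ _ := by rw [div_le_iff₀ hKJ, mul_comm _ p.KJ]; exact h6
  set B := p.σlow ^ 2 * γ ^ 4 with hB
  have hB0 : 0 < B := by positivity
  have hvB : B ≤ ‖R.vbar k‖ ^ 2 := by
    calc B = (p.σlow * γ ^ 2) ^ 2 := by rw [hB]; ring
      _ ≤ _ := by gcongr
  have hu : ‖R.ubar k‖ ^ 2 * B ≤ p.κu ^ 2 * ‖R.vbar k‖ ^ 2 := by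
    have := hR.norm_ubar_le hp hP k
    gcongr
  have hd : B * ‖dk R k‖ ^ 2
      ≤ 2 * (p.κu ^ 2 + B) * (p.σJc ^ 2 * ‖JTck P R k‖ ^ 2) := by
    have h2 := norm_dk_sq_le (R := R) k
    calc B * ‖dk R k‖ ^ 2 ≤ B * (2 * ‖R.ubar k‖ ^ 2 + 2 * ‖R.vbar k‖ ^ 2) := by gcongr
      _ ≤ 2 * (p.κu ^ 2 + B) * ‖R.vbar k‖ ^ 2 := by linarith
      _ ≤ _ := by
        have := hR.norm_vbar_sq_le hp k
        gcongr
  refine le_trans ?_ h1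
  have e1 : p.κΔ0 γ * ‖dk R k‖ ^ 2 = p.σc * p.σv / p.Kc
      * (B * ‖dk R k‖ ^ 2 / (2 * (p.κu ^ 2 + B) * p.σJc ^ 2)) := by
    unfold Params.κΔ0
    rw [mul_assoc (p.σc * p.σv), ← hB]
    field_simp
  rw [e1]
  gcongr
  rw [div_le_iff₀ (by positivity)]
  linarith

end Basic

/-! ### Step sizes of the adaptive rule -/

section Adaptive

/-- The weight by which the ratio of model reduction and squared step length is normalized in the
adaptive rule. -/
def _root_.NoisySQP.domWeight (R : Iterates n m) (k : ℕ) : ℝ :=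
  open Classical in if TangDom R k (R.χ k) then R.τ k else 1

lemma _root_.NoisySQP.ξtrial_eq (k : ℕ) :
    ξtrial P R k = Δk P R k / (domWeight R k * ‖dk R k‖ ^ 2) := by
  unfold ξtrial domWeight
  split_ifs <;> simp

lemma _root_.NoisySQP.αmin_eq (k : ℕ) :
    αmin p R k = 2 * (1 - p.η) * p.β * R.ξ k * domWeight R k / (R.τ k * p.L + p.Γ) := by
  unfold αmin domWeight
  split_ifs <;> simp

variable (hR : IsRun P p .adaptive X R) (hp : p.Valid .adaptive)
include hR hp

lemma domWeight_pos (k : ℕ) : 0 < domWeight R k := by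
  unfold domWeight
  split_ifs
  · exact hR.τ_pos hp.common k
  · exact one_pos

lemma ξtrial_pos (hP : Regular P p X) (k : ℕ) : 0 < ξtrial P R k := by
  have := hR.Δk_pos hp.common hP k
  have := hR.norm_dk_pos hp.common hP k
  have := hR.domWeight_pos hp k
  rw [ξtrial_eq]
  positivity

lemma ξ_pos_le (hP : Regular P p X) (k : ℕ) (h0 : 0 < prev p.ξ0 R.ξ k) :
    0 < R.ξ k ∧ R.ξ k ≤ prev p.ξ0 R.ξ k ∧ R.ξ k ≤ ξtrial P R k := by
  have hs : AdaptiveStep P p R k := hR.stepSize k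
  have h1 := hR.ξtrial_pos hp hP k
  have h2 := hp.2.σξ
  rw [hs.ξ_eq]
  split_ifs with h
  · exact ⟨h0, le_rfl, h⟩
  · refine ⟨lt_min (mul_pos (by linarith) h0) h1, (min_le_left _ _).trans ?_, min_le_right _ _⟩
    nlinarith

lemma ξprev_pos (hP : Regular P p X) (k : ℕ) : 0 < prev p.ξ0 R.ξ k := by
  induction k with
  | zero => exact hp.2.ξ0
  | succ k ih => exact (hR.ξ_pos_le hp hP k ih).1

lemma ξ_le (hP : Regular P p X) (k : ℕ) : R.ξ k ≤ p.ξ0 := by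
  induction k with
  | zero => exact (hR.ξ_pos_le hp hP 0 (hR.ξprev_pos hp hP 0)).2.1
  | succ k ih => exact (hR.ξ_pos_le hp hP (k + 1) (hR.ξprev_pos hp hP (k + 1))).2.1.trans ih

/-- Since `χ` can only grow, a tangentially dominated step always satisfies `‖v̄‖² ≤ χ0⁻¹ ‖ū‖²`. -/
lemma χ_ge (k : ℕ) : p.χ0 ≤ R.χ k := by
  have key : ∀ k, p.χ0 ≤ prev p.χ0 R.χ k → p.χ0 ≤ R.χ k := by
    intro k h
    have hs : AdaptiveStep P p R k := hR.stepSize k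
    have := hp.2.χ0
    have := hp.2.σχ
    rw [hs.χ_eq]
    split_ifs
    · nlinarith
    · exact h
  induction k with
  | zero => exact key 0 le_rfl
  | succ k ih => exact key (k + 1) ih

/-- `ξ` is lowered only when it exceeds the trial value, and then to no less than `(1 - σξ)` times
that value; so a lower bound for the trial values suffices. -/
lemma ξ_ge (hP : Regular P p X) {τmin : ℝ} (hτmin : 0 < τmin) (hτ : ∀ k, τmin ≤ R.τ k) (k : ℕ) :
    p.ξmin τmin ≤ R.ξ k := by
  have hpc := hp.common
  have htrial : ∀ k, min (p.σu * p.lamu / (2 * (1 + p.χ0⁻¹))) (p.κΔ τmin) ≤ ξtrial P R k := by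
    intro k
    have hτk := hR.τ_pos hpc k
    have hd := hR.norm_dk_pos hpc hP k
    have hσu := hpc.σu.1
    have hlamu := hpc.lamu.1
    have hχ0 := hp.2.χ0
    unfold ξtrial
    split_ifs with h
    -- Tangentially dominated: the weight `τ` cancels the `τ` in the bound for `Δ`, so `τmin` does
    -- not enter, and `‖d̄‖² ≤ 2 (1 + χ0⁻¹) ‖ū‖²`. For a zero normal step the same factor covers the
    -- slack.
    · refine (min_le_left _ _).trans ?_
      rw [div_le_div_iff₀ (by positivity) (by positivity)]
      rcases le_or_gt ‖ck P R k‖ p.εo with hc | hc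
      · have h1 := hR.le_Δk_of_small hpc hc
        have h2 : dk R k = R.ubar k := by rw [dk, ((hR.direction k).small hc).1, zero_add]
        have h3 := hR.Δk_pos hpc hP k
        have h4 : 0 ≤ Δk P R k * p.χ0⁻¹ := by positivity
        rw [h2]
        linarith
      · have h1 := hR.le_Δk_of_large hpc hc
        have h2 := mul_pos hpc.σc.1 ((hR.direction k).normalRed_pos hpc hc (hR.norm_Jk_le hP k))
        have h3 : ‖R.vbar k‖ ^ 2 ≤ p.χ0⁻¹ * ‖R.ubar k‖ ^ 2 := by
          rw [inv_mul_eq_div, le_div_iff₀ hχ0, mul_comm]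
          exact (mul_le_mul_of_nonneg_right (hR.χ_ge hp k) (sq_nonneg _)).trans h
        have h4 := norm_dk_sq_le (R := R) k
        calc p.σu * p.lamu * (R.τ k * ‖dk R k‖ ^ 2)
            ≤ p.σu * p.lamu * (R.τ k * (2 * (1 + p.χ0⁻¹) * ‖R.ubar k‖ ^ 2)) := by
              gcongr
              linarith
          _ = R.τ k * p.σu * p.lamu * ‖R.ubar k‖ ^ 2 * (2 * (1 + p.χ0⁻¹)) := by ring
          _ ≤ Δk P R k * (2 * (1 + p.χ0⁻¹)) := by
              gcongr
              linarith
    · refine (min_le_right _ _).trans ?_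
      rw [le_div_iff₀ (by positivity)]
      exact hR.κΔ_mul_le hpc hP hτmin (hτ k)
  have hσξ := hp.2.σξ
  have hmin : p.ξmin τmin ≤ (1 - p.σξ) * min (p.σu * p.lamu / (2 * (1 + p.χ0⁻¹))) (p.κΔ τmin) := by
    rw [mul_min_of_nonneg _ _ (by linarith)]
    refine (min_le_right _ _).trans (le_of_eq ?_)
    congr 1
    ring
  have key : ∀ k, p.ξmin τmin ≤ prev p.ξ0 R.ξ k → p.ξmin τmin ≤ R.ξ k := by
    intro k h
    have hs : AdaptiveStep P p R k := hR.stepSize k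
    have h1 : p.ξmin τmin ≤ (1 - p.σξ) * ξtrial P R k :=
      hmin.trans (mul_le_mul_of_nonneg_left (htrial k) (by linarith))
    have h2 := hR.ξtrial_pos hp hP k
    rw [hs.ξ_eq]
    split_ifs with h3
    · exact h
    · push Not at h3
      refine le_min ?_ ?_ <;> nlinarith
  induction k with
  | zero => exact key 0 (min_le_left _ _)
  | succ k ih => exact key (k + 1) ih

lemma αmin_pos (hP : Regular P p X) (k : ℕ) : 0 < αmin p R k := by
  have := (hR.ξ_pos_le hp hP k (hR.ξprev_pos hp hP k)).1
  have := hR.domWeight_pos hp k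
  have := hR.lipschitz_pos hp.common k
  have := hp.2.β.1
  have : 0 < 1 - p.η := by linarith [hp.common.η.2]
  rw [αmin_eq]
  positivity

lemma αmin_le_ratio (hP : Regular P p X) (k : ℕ) :
    αmin p R k
      ≤ 2 * (1 - p.η) * p.β * Δk P R k / ((R.τ k * p.L + p.Γ) * ‖dk R k‖ ^ 2) := by
  have h1 := (hR.ξ_pos_le hp hP k (hR.ξprev_pos hp hP k)).2.2
  have h2 := hR.domWeight_pos hp k
  have h3 := hR.lipschitz_pos hp.common k
  have h4 := hp.2.β.1
  have h5 : 0 < 1 - p.η := by linarith [hp.common.η.2]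
  have h6 := hR.norm_dk_pos hp.common hP k
  rw [ξtrial_eq, le_div_iff₀ (by positivity)] at h1
  rw [αmin_eq, div_le_div_iff₀ h3 (by positivity)]
  calc _ = 2 * (1 - p.η) * p.β * (R.ξ k * (domWeight R k * ‖dk R k‖ ^ 2))
        * (R.τ k * p.L + p.Γ) := by ring
    _ ≤ _ := by gcongr

lemma αmin_le_one (hP : Regular P p X) (k : ℕ) : αmin p R k ≤ 1 := by
  have h1 := hR.ξ_le hp hP k
  have h3 := hR.lipschitz_pos hp.common k
  have h4 := hp.2.β.1
  have h5 : 0 < 1 - p.η := by linarith [hp.common.η.2]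
  have hΓ := hp.2.Γ
  have hτ := hR.τ_pos hp.common k
  have hτ0 := hp.common.τ0
  have hL := hp.common.L
  have hξ0 := hp.2.ξ0
  unfold αmin
  split_ifs
  · refine le_trans ?_ hp.2.small
    rw [div_le_div_iff₀ h3 (by positivity)]
    have hle := hR.τ_le hp.common k
    -- Monotonicity of `t ↦ t / (t L + Γ)`, with denominators cleared.
    have h6 : R.τ k * (p.τ0 * p.L + p.Γ) ≤ p.τ0 * (R.τ k * p.L + p.Γ) := by nlinarith
    calc _ = 2 * (1 - p.η) * p.β * R.ξ k * (R.τ k * (p.τ0 * p.L + p.Γ)) := by ring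
      _ ≤ 2 * (1 - p.η) * p.β * p.ξ0 * (p.τ0 * (R.τ k * p.L + p.Γ)) := by gcongr
      _ = _ := by ring
  · refine le_trans ?_ hp.2.small'
    have : p.Γ ≤ R.τ k * p.L + p.Γ := by nlinarith
    gcongr

lemma αmin_le_const (hP : Regular P p X) (k : ℕ) :
    αmin p R k ≤ 2 * (1 - p.η) * p.ξ0 * max p.τ0 1 / p.Γ * p.β := by
  have h1 := hR.ξ_le hp hP k
  have h3 := hR.lipschitz_pos hp.common k
  have h4 := hp.2.β.1
  have h5 : 0 < 1 - p.η := by linarith [hp.common.η.2]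
  have hΓ := hp.2.Γ
  have hξ0 := hp.2.ξ0
  have hw0 := hR.domWeight_pos hp k
  have hw : domWeight R k ≤ max p.τ0 1 := by
    unfold domWeight
    split_ifs
    · exact (hR.τ_le hp.common k).trans (le_max_left _ _)
    · exact le_max_right _ _
  have h6 : p.Γ ≤ R.τ k * p.L + p.Γ := by nlinarith [hR.τ_pos hp.common k, hp.common.L]
  rw [αmin_eq]
  calc _ ≤ 2 * (1 - p.η) * p.β * p.ξ0 * max p.τ0 1 / p.Γ := by gcongr
    _ = _ := by ring

/-- The projected value is either `αmin` or at most `αsuff`. The latter obeys the ratio bound by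
definition, the former because `ξ ≤ ξtrial`; so the safeguard never spoils sufficient decrease. -/
lemma α_bounds_adaptive (hP : Regular P p X) (k : ℕ) :
    0 < R.α k ∧ R.α k ≤ 1 ∧ R.α k ≤ p.αup .adaptive ∧
      R.α k ≤ 2 * (1 - p.η) * p.β * Δk P R k / ((R.τ k * p.L + p.Γ) * ‖dk R k‖ ^ 2) := by
  have hs : AdaptiveStep P p R k := hR.stepSize k
  rw [hs.α_eq]
  refine ⟨lt_max_of_lt_left (hR.αmin_pos hp hP k), max_le (hR.αmin_le_one hp hP k) ?_,
    max_le ?_ ?_, max_le (hR.αmin_le_ratio hp hP k) ?_⟩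
  · exact (min_le_left _ _).trans (min_le_right _ _)
  · have h1 := hR.αmin_le_const hp hP k
    have h2 := mul_pos hp.2.θ hp.2.β.1
    rw [Params.αup, add_mul]
    linarith
  · refine (min_le_right _ _).trans ?_
    rw [Params.αup, αmax, add_mul]
    exact add_le_add (hR.αmin_le_const hp hP k) le_rfl
  · exact (min_le_left _ _).trans (min_le_left _ _)

lemma αlow_le_adaptive (hP : Regular P p X) {τmin : ℝ} (hτmin : 0 < τmin)
    (hτ : ∀ k, τmin ≤ R.τ k) (k : ℕ) : p.αlow τmin .adaptive ≤ R.α k := by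
  have hs : AdaptiveStep P p R k := hR.stepSize k
  have hξ := hR.ξ_ge hp hP hτmin hτ k
  have h3 := hR.lipschitz_pos hp.common k
  have h4 := hp.2.β.1
  have h5 : 0 < 1 - p.η := by linarith [hp.common.η.2]
  have hΓ := hp.2.Γ
  have hL := hp.common.L
  have hτ0 := hp.common.τ0
  have hξ0 := (hR.ξ_pos_le hp hP k (hR.ξprev_pos hp hP k)).1
  have hw0 := hR.domWeight_pos hp k
  have hw : min (τmin / (τmin * p.L + p.Γ)) (1 / (p.τ0 * p.L + p.Γ))
      ≤ domWeight R k / (R.τ k * p.L + p.Γ) := by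
    unfold domWeight
    split_ifs
    · refine (min_le_left _ _).trans ?_
      rw [div_le_div_iff₀ (by positivity) h3]
      nlinarith [hτ k]
    · refine (min_le_right _ _).trans ?_
      have := hR.lipschitz_le hp.common k
      gcongr
  rw [hs.α_eq]
  refine le_trans ?_ (le_max_left _ _)
  rw [αmin_eq, Params.αlow]
  calc _ ≤ 2 * (1 - p.η) * p.β * R.ξ k * (domWeight R k / (R.τ k * p.L + p.Γ)) := by gcongr
    _ = _ := by ring

/-- Here `αmin` may be arbitrarily small, so the bound comes from `αsuff` and `αmax`; all that is
used of `αmax` is that it exceeds `θ β`. The explicit fraction in `αlow0` is `2 (1 - η) β κΔ0 / (τ0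
L + Γ)` written out. -/
lemma αlow0_le_adaptive (hP : Regular P p X) {γ : ℝ} (hγ : 0 < γ) {k : ℕ}
    (h : p.εo < ‖ck P R k‖) (hJc : γ ≤ ‖JTck P R k‖) : p.αlow0 γ .adaptive ≤ R.α k := by
  have hpc := hp.common
  have hs : AdaptiveStep P p R k := hR.stepSize k
  have h1 := hR.κΔ0_mul_le hpc hP hγ h hJc
  have h3 := hR.lipschitz_pos hpc k
  have h4 := hp.2.β.1
  have h5 : 0 < 1 - p.η := by linarith [hpc.η.2]
  have h6 := hR.norm_dk_pos hpc hP k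
  have h7 := hR.lipschitz_le hpc k
  have hκu := hpc.κu_pos
  have hσl := hpc.σlow_pos
  have hσc := hpc.σc.1
  have hσv := hpc.σv_pos
  have hKc := hpc.Kc_pos
  have hσJ := hpc.σJc
  have hκ : 0 ≤ p.κΔ0 γ := by unfold Params.κΔ0; positivity
  have hA : (1 - p.η) * p.β * p.σc * p.σv * p.σlow ^ 2 * γ ^ 4
      / ((p.τ0 * p.L + p.Γ) * p.Kc * p.σJc ^ 2 * (p.κu ^ 2 + p.σlow ^ 2 * γ ^ 4))
      ≤ 2 * (1 - p.η) * p.β * Δk P R k / ((R.τ k * p.L + p.Γ) * ‖dk R k‖ ^ 2) := by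
    calc _ = 2 * (1 - p.η) * p.β * p.κΔ0 γ / (p.τ0 * p.L + p.Γ) := by
          have : 0 < p.κu ^ 2 + p.σlow ^ 2 * γ ^ 4 := by positivity
          have : 0 < p.τ0 * p.L + p.Γ := h3.trans_le h7
          unfold Params.κΔ0
          field_simp
      _ ≤ 2 * (1 - p.η) * p.β * p.κΔ0 γ / (R.τ k * p.L + p.Γ) := by gcongr
      _ ≤ _ := by
        rw [div_le_div_iff₀ h3 (by positivity)]
        calc _ = 2 * (1 - p.η) * p.β * (p.κΔ0 γ * ‖dk R k‖ ^ 2) * (R.τ k * p.L + p.Γ) := by ring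
          _ ≤ _ := by gcongr
  rw [hs.α_eq]
  refine le_trans ?_ (le_max_right _ _)
  unfold Params.αlow0 αsuff αmax
  refine le_min (le_min ?_ ?_) ?_
  · exact (min_le_left _ _).trans hA
  · exact (min_le_right _ _).trans (min_le_left _ _)
  · refine ((min_le_right _ _).trans (min_le_right _ _)).trans ?_
    linarith [hR.αmin_pos hp hP k]

end Adaptive

/-- The curvature term in the bound for the merit function is dominated by the model reduction
for steps which are short enough. -/
lemma _root_.NoisySQP.curvature_le {η β l a D N : ℝ} (hβ : β ≤ 1) (hη : η ≤ 1) (hD : 0 ≤ D)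
    (hl : 0 < l) (hN : 0 < N) (ha0 : 0 ≤ a) (ha : a ≤ 2 * (1 - η) * β * D / (l * N)) :
    1 / 2 * l * a ^ 2 * N ≤ (1 - η) * a * D := by
  rw [le_div_iff₀ (by positivity)] at ha
  have h1 : (1 - η) * β * D ≤ (1 - η) * D := by
    have := mul_nonneg (sub_nonneg.2 hη) hD
    nlinarith
  nlinarith

/-! ### Step sizes of the line search -/

section LineSearch

variable (hR : IsRun P p .lineSearch X R) (hp : p.Valid .lineSearch)
include hR hp

lemma α_bounds_lineSearch (k : ℕ) :
    0 < R.α k ∧ R.α k ≤ 1 ∧ R.α k ≤ p.αup .lineSearch := by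
  obtain ⟨j, hα, -, -⟩ : LineSearchStep P p R k := hR.stepSize k
  have h1 := hp.2.αuL
  have h2 := hp.2.ν
  have h3 : p.ν ^ j ≤ 1 := pow_le_one₀ h2.1.le h2.2.le
  have h4 : 0 < p.ν ^ j := pow_pos h2.1 j
  have h5 : p.αuL * p.ν ^ j ≤ p.αuL := by nlinarith
  rw [hα]
  exact ⟨mul_pos h1.1 h4, h5.trans h1.2, h5⟩

/-- Unless the first trial is accepted, the trial step before `α`, of length `α / ν`, was rejected.
The relaxation covers all noise, so rejection means that the curvature term beats `(1 - η) Δ`, which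
bounds that trial step below. The constant `κ` is free so that `κΔ` and `κΔ0` both fit. -/
lemma min_le_lineSearch (hP : Regular P p X) {κ : ℝ} {k : ℕ}
    (hκ : κ * ‖dk R k‖ ^ 2 ≤ Δk P R k) :
    min p.αuL (p.ν * (1 - p.η) * κ / (p.τ0 * p.L + p.Γ)) ≤ R.α k := by
  have hpc := hp.common
  obtain ⟨j, hα, -, hj⟩ : LineSearchStep P p R k := hR.stepSize k
  have h1 := hp.2.αuL
  have h2 := hp.2.ν
  have hη : 0 < 1 - p.η := by linarith [hpc.η.2]
  have hl := hR.lipschitz_pos hpc k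
  have hll := hR.lipschitz_le hpc k
  have hd := hR.norm_dk_pos hpc hP k
  have hτ := hR.τ_pos hpc k
  cases j with
  | zero =>
    rw [hα, pow_zero, mul_one]
    exact min_le_left _ _
  | succ j =>
    refine (min_le_right _ _).trans ?_
    have hfail := hj j (Nat.lt_succ_self j)
    set a := p.αuL * p.ν ^ j with ha
    have hαa : R.α k = p.ν * a := by rw [hα, ha]; ring
    have hνj : 0 < p.ν ^ j := pow_pos h2.1 j
    have ha0 : 0 < a := mul_pos h1.1 hνj
    have hau : a ≤ p.αuL := by
      have : p.ν ^ j ≤ 1 := pow_le_one₀ h2.1.le h2.2.le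
      nlinarith
    have ha1 : a ≤ 1 := hau.trans h1.2
    have hmem : R.x k + a • dk R k ∈ X :=
      hP.convex.add_smul_mem (hR.x_mem k) (hR.trial_mem k) ⟨ha0.le, ha1⟩
    unfold Armijo at hfail
    push Not at hfail
    -- Two conversions between the noisy and exact merit functions cost `2 τ εf + 2 εc`, and
    -- `merit_le` costs another `2 εc`: exactly the constant part of `relax`.
    have e1 := hP.noisyMerit_le_merit hmem hτ.le
    have e2 := hP.merit_le (hR.x_mem k) hτ.le ha0.le ha1 hmem
    have e3 := hP.merit_le_noisyMerit (hR.x_mem k) hτ.le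
    have e4 : a * R.τ k * p.εg * ‖dk R k‖ ≤ R.τ k * p.αuL * p.εg * ‖dk R k‖ := by
      have := hpc.εg
      rw [mul_comm a]
      gcongr
    have e5 : a * p.εJ * ‖dk R k‖ ≤ p.αuL * p.εJ * ‖dk R k‖ := by
      have := hpc.εJ
      gcongr
    have e6 : modelRed P (R.x k) (R.τ k) (dk R k) = Δk P R k := rfl
    unfold relax at hfail
    rw [e6] at e2
    have e7 : a * ((1 - p.η) * Δk P R k)
        < a * (1 / 2 * (R.τ k * p.L + p.Γ) * a * ‖dk R k‖ ^ 2) := by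
      linarith
    have e8 := lt_of_mul_lt_mul_left e7 ha0.le
    -- The factor `1 / 2` of the curvature term is discarded, since the stated constant does not use
    -- it.
    have e9 : (1 - p.η) * κ ≤ (R.τ k * p.L + p.Γ) * a := by
      have hd2 : 0 < ‖dk R k‖ ^ 2 := by positivity
      refine le_of_mul_le_mul_right ?_ hd2
      have e10 := mul_le_mul_of_nonneg_left hκ hη.le
      have e11 : 0 ≤ (R.τ k * p.L + p.Γ) * a * ‖dk R k‖ ^ 2 := by positivity
      linarith
    rw [hαa, mul_assoc, mul_div_assoc]
    refine mul_le_mul_of_nonneg_left ?_ h2.1.le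
    rw [div_le_iff₀ (hl.trans_le hll)]
    refine e9.trans ?_
    rw [mul_comm]
    gcongr

end LineSearch

/-! ### Both rules: merit decrease and counting of iterations -/

variable (hR : IsRun P p rule X R) (hp : p.Valid rule) (hP : Regular P p X)
include hR hp hP

lemma αlow_le {τmin : ℝ} (hτmin : 0 < τmin) (hτ : ∀ k, τmin ≤ R.τ k) (k : ℕ) :
    p.αlow τmin rule ≤ R.α k := by
  cases rule with
  | adaptive => exact hR.αlow_le_adaptive hp hP hτmin hτ k
  | lineSearch => exact hR.min_le_lineSearch hp hP (hR.κΔ_mul_le hp.common hP hτmin (hτ k))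

lemma αlow0_le {γ : ℝ} (hγ : 0 < γ) {k : ℕ} (h : p.εo < ‖ck P R k‖)
    (hJc : γ ≤ ‖JTck P R k‖) : p.αlow0 γ rule ≤ R.α k := by
  cases rule with
  | adaptive => exact hR.αlow0_le_adaptive hp hP hγ h hJc
  | lineSearch => exact hR.min_le_lineSearch hp hP (hR.κΔ0_mul_le hp.common hP hγ h hJc)

/-- Decrease of the exact merit function, up to noise, in every iteration. -/
lemma merit_succ_le (k : ℕ) : merit P (R.x (k + 1)) (R.τ k)
    ≤ merit P (R.x k) (R.τ k) - p.η * R.α k * Δk P R k + p.Emerit rule := by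
  have hpc := hp.common
  have hτ := hR.τ_pos hpc k
  have hτ0 := hR.τ_le hpc k
  have hτ00 := hpc.τ0
  have hd := hR.norm_dk_le hpc hP k
  have hεg := hpc.εg
  have hεJ := hpc.εJ
  have hεf := hpc.εf
  cases rule with
  | adaptive =>
    obtain ⟨h0, h1, h2, h3⟩ := hR.α_bounds_adaptive hp hP k
    have hmem : R.x k + R.α k • dk R k ∈ X := hR.update k ▸ hR.x_mem (k + 1)
    have e2 := hP.merit_le (hR.x_mem k) hτ.le h0.le h1 hmem
    have hdp := hR.norm_dk_pos hpc hP k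
    have e3 := curvature_le hp.2.β.2 hpc.η.2.le (hR.Δk_pos hpc hP k).le (hR.lipschitz_pos hpc k)
      (by positivity) h0.le h3
    have e6 : modelRed P (R.x k) (R.τ k) (dk R k) = Δk P R k := rfl
    rw [e6, ← hR.update k] at e2
    have hup : 0 ≤ p.αup .adaptive := h0.le.trans h2
    have e4 : R.α k * R.τ k * p.εg * ‖dk R k‖ ≤ p.αup .adaptive * p.τ0 * p.κd * p.εg := by
      calc _ ≤ p.αup .adaptive * p.τ0 * p.εg * p.κd := by gcongr
        _ = _ := by ring
    have e5 : R.α k * p.εJ * ‖dk R k‖ ≤ p.αup .adaptive * p.κd * p.εJ := by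
      calc _ ≤ p.αup .adaptive * p.εJ * p.κd := by gcongr
        _ = _ := by ring
    unfold Params.Emerit
    linarith
  | lineSearch =>
    obtain ⟨j, hα, hA, -⟩ : LineSearchStep P p R k := hR.stepSize k
    rw [← hα] at hA
    unfold Armijo at hA
    rw [← hR.update k] at hA
    -- Two more conversions raise the noise from `2 τ εf + 4 εc` in `relax` to `4 τ εf + 6 εc`.
    have e1 := hP.merit_le_noisyMerit (hR.x_mem (k + 1)) hτ.le
    have e2 := hP.noisyMerit_le_merit (hR.x_mem k) hτ.le
    have hup := hp.2.αuL.1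
    have e3 : R.τ k * p.εf ≤ p.τ0 * p.εf := by gcongr
    have e4 : R.τ k * p.αuL * p.εg * ‖dk R k‖ ≤ p.τ0 * p.αuL * p.κd * p.εg := by
      calc _ ≤ p.τ0 * p.αuL * p.εg * p.κd := by gcongr
        _ = _ := by ring
    have e5 : p.αuL * p.εJ * ‖dk R k‖ ≤ p.αuL * p.κd * p.εJ := by
      calc _ ≤ p.αuL * p.εJ * p.κd := by gcongr
        _ = _ := by ring
    unfold relax at hA
    simp only [Params.Emerit, Params.αup]
    linarith

/-- If the merit function decreases by at least `δ` in each of the first `N` iterations, then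
`N * δ` is bounded by the initial gap. -/
lemma mul_le_gap {δ : ℝ} {N : ℕ}
    (hδ : ∀ k < N, δ ≤ p.η * R.α k * Δk P R k - p.Emerit rule) : N * δ ≤ gap P p R := by
  have hpc := hp.common
  have htel : ∀ j ≤ N, merit P (R.x j) (R.τ j) + j * δ
      ≤ merit P (R.x 0) (R.τ 0) + (R.τ 0 - R.τ j) * |p.fInf| := by
    intro j
    induction j with
    | zero => simp
    | succ j ih =>
      intro hj
      have h1 := ih (by omega)
      have h2 := hR.merit_succ_le hp hP j
      have h3 := hδ j (by omega)
      -- Lowering `τ` can raise the merit function only where `f < 0`, by at most the change of `τ`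
      -- times `|fInf|`; these changes telescope.
      have h4 : merit P (R.x (j + 1)) (R.τ (j + 1))
          ≤ merit P (R.x (j + 1)) (R.τ j) + (R.τ j - R.τ (j + 1)) * |p.fInf| := by
        have h5 := (neg_abs_le p.fInf).trans (hP.f_lower _ (hR.x_mem (j + 1)))
        have h6 := mul_le_mul_of_nonneg_left h5 (sub_nonneg.2 (hR.τ_succ_le hpc j))
        unfold merit
        linarith
      push_cast
      linarith
  have h1 := htel N le_rfl
  have hτN := hR.τ_pos hpc N
  have h2 : p.φmin ≤ merit P (R.x N) (R.τ N) := by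
    have h3 := mul_le_mul_of_nonneg_left (hP.f_lower _ (hR.x_mem N)) hτN.le
    have h4 := norm_nonneg (P.c (R.x N))
    have h5 : p.φmin ≤ R.τ N * p.fInf := by
      rcases le_or_gt 0 p.fInf with h | h
      · exact (min_le_left _ _).trans (mul_nonneg hτN.le h)
      · exact (min_le_right _ _).trans (mul_le_mul_of_nonpos_right (hR.τ_le hpc N) h.le)
    unfold merit
    linarith
  have h3 : (R.τ 0 - R.τ N) * |p.fInf| ≤ p.τ0 * |p.fInf| := by
    have := hR.τ_le hpc 0
    gcongr
    linarith
  unfold gap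
  linarith

/-- Counting iterations: a property which fails only at iterations with a decrease of at least
`δ` holds within the number of iterations given by the initial gap. -/
lemma exists_le_ceil {δ : ℝ} (hδ : 0 < δ) {Q : ℕ → Prop}
    (hQ : ∀ k, ¬ Q k → δ ≤ p.η * R.α k * Δk P R k - p.Emerit rule) :
    ∃ k ≤ ⌈gap P p R / δ⌉₊, Q k := by
  by_contra! h
  -- Failure at all indices `0, …, K` gives `K + 1` decreases; the extra one produces the strict
  -- contradiction.
  have h1 := hR.mul_le_gap hp hP (N := ⌈gap P p R / δ⌉₊ + 1)
    (fun k hk => hQ k (h k (Nat.lt_succ_iff.1 hk)))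
  have h2 := Nat.le_ceil (gap P p R / δ)
  rw [div_le_iff₀ hδ] at h2
  push_cast at h1
  linarith

end IsRun

end Run

/-! ### Signs of the complexity constants -/

namespace Params

variable {p : Params}

lemma EJc1_le_EJc2 : p.EJc1 ≤ p.EJc2 := le_max_left _ _

lemma ValidCommon.κΔ_pos (hp : p.ValidCommon) {τmin : ℝ} (hτmin : 0 < τmin) : 0 < p.κΔ τmin := by
  have hσu := hp.σu.1
  have hlamu := hp.lamu.1
  have hσc := hp.σc.1
  have hσv := hp.σv_pos
  have hKc := hp.Kc_pos
  exact div_pos (lt_min (by positivity) (by positivity)) (lt_max_of_lt_left two_pos)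

lemma ValidCommon.κΔ0_pos (hp : p.ValidCommon) {γ : ℝ} (hγ : 0 < γ) : 0 < p.κΔ0 γ := by
  have hκu := hp.κu_pos
  have hσl := hp.σlow_pos
  have hσc := hp.σc.1
  have hσv := hp.σv_pos
  have hKc := hp.Kc_pos
  have hσJ := hp.σJc
  unfold Params.κΔ0
  positivity

lemma ValidCommon.EJc1_nonneg (hp : p.ValidCommon) : 0 ≤ p.EJc1 := by
  have := hp.EJc_nonneg
  have := hp.KJ_pos
  have := hp.Kc_pos
  have := hp.κJ
  have := hp.κc
  unfold Params.EJc1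
  positivity

lemma Valid.Emerit_nonneg {rule : StepRule} (hp : p.Valid rule) : 0 ≤ p.Emerit rule := by
  have hpc := hp.common
  have hκd : 0 ≤ p.κd := by
    have := hpc.κu_pos
    have := hpc.σJc
    have := hpc.KJ_pos
    have := hpc.Kc_pos
    unfold Params.κd
    positivity
  have hτ0 := hpc.τ0
  have hεf := hpc.εf
  have hεg := hpc.εg
  have hεc := hpc.εc
  have hεJ := hpc.εJ
  have hαup : 0 ≤ p.αup rule := by
    cases rule with
    | adaptive =>
      have hη : 0 < 1 - p.η := by linarith [hpc.η.2]
      have := hp.2.ξ0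
      have := hp.2.Γ
      have := hp.2.θ
      have := hp.2.β.1
      have : 0 < max p.τ0 1 := lt_max_of_lt_left hτ0
      unfold Params.αup
      positivity
    | lineSearch => exact hp.2.αuL.1.le
  cases rule <;> unfold Params.Emerit <;> positivity

lemma κ1_nonneg (p : Params) : 0 ≤ p.κ1 := by
  unfold Params.κ1
  positivity

lemma κ2_nonneg (p : Params) : 0 ≤ p.κ2 := by
  unfold Params.κ2
  positivity

lemma Valid.αlow_pos {rule : StepRule} (hp : p.Valid rule) {τmin : ℝ} (hτmin : 0 < τmin) :
    0 < p.αlow τmin rule := by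
  have hpc := hp.common
  have hκ := hpc.κΔ_pos hτmin
  have hη : 0 < 1 - p.η := by linarith [hpc.η.2]
  have hL := hpc.L
  have hτ0 := hpc.τ0
  have hΓ := hpc.Γ
  have hσu := hpc.σu.1
  have hlamu := hpc.lamu.1
  cases rule with
  | adaptive =>
    have hσξ : 0 < 1 - p.σξ := by linarith [hp.2.σξ.2]
    have hχ := hp.2.χ0
    have hβ := hp.2.β.1
    have hξ : 0 < p.ξmin τmin :=
      lt_min hp.2.ξ0 (lt_min (by positivity) (by positivity))
    have : 0 < min (τmin / (τmin * p.L + p.Γ)) (1 / (p.τ0 * p.L + p.Γ)) :=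
      lt_min (by positivity) (by positivity)
    unfold Params.αlow
    positivity
  | lineSearch =>
    have := hp.2.ν.1
    exact lt_min hp.2.αuL.1 (by positivity)

lemma Valid.αlow0_pos {rule : StepRule} (hp : p.Valid rule) {γ : ℝ} (hγ : 0 < γ) :
    0 < p.αlow0 γ rule := by
  have hpc := hp.common
  have hκ := hpc.κΔ0_pos hγ
  have hη : 0 < 1 - p.η := by linarith [hpc.η.2]
  have hL := hpc.L
  have hτ0 := hpc.τ0
  have hΓ := hpc.Γ
  have hκu := hpc.κu_pos
  have hσl := hpc.σlow_pos
  have hσc := hpc.σc.1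
  have hσv := hpc.σv_pos
  have hKc := hpc.Kc_pos
  have hσJ := hpc.σJc
  cases rule with
  | adaptive =>
    have hβ := hp.2.β.1
    exact lt_min (by positivity) (lt_min one_pos (mul_pos hp.2.θ hβ))
  | lineSearch =>
    have := hp.2.ν.1
    exact lt_min hp.2.αuL.1 (by positivity)

end Params

namespace IsRun

variable {n m : ℕ} {P : NoisyProblem n m} {p : Params} {rule : StepRule} {X : Set (Vec n)}
  {R : Iterates n m}

/-! ### True errors in terms of computed quantities and noise -/

section Errors

variable (hR : IsRun P p rule X R) (hp : p.ValidCommon) (hP : Regular P p X)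
include hR hp hP

omit hp in
lemma infErr_le (k : ℕ) : infErr P R k ≤ p.κJ * feasErr P R k := by
  refine (ContinuousLinearMap.le_opNorm _ _).trans ?_
  rw [norm_tr]
  exact mul_le_mul_of_nonneg_right (hP.J_bound _ (hR.x_mem k)) (norm_nonneg _)

lemma infErr_le_add (k : ℕ) : infErr P R k ≤ ‖JTck P R k‖ + p.EJc := by
  have hx := hR.x_mem k
  have h1 : tr (P.J (R.x k)) (P.c (R.x k)) = JTck P R k
      - (tr (Jk P R k) (ck P R k - P.c (R.x k)) + tr (Jk P R k - P.J (R.x k)) (P.c (R.x k))) := by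
    unfold JTck tr
    rw [map_sub, map_sub, sub_apply]
    abel
  have h2 : ‖tr (Jk P R k) (ck P R k - P.c (R.x k))‖ ≤ p.KJ * p.εc := by
    refine (ContinuousLinearMap.le_opNorm _ _).trans ?_
    rw [norm_tr]
    exact mul_le_mul (hR.norm_Jk_le hP k) (hP.noise_c _ hx) (norm_nonneg _) hp.KJ_pos.le
  have h3 : ‖tr (Jk P R k - P.J (R.x k)) (P.c (R.x k))‖ ≤ p.εJ * p.κc := by
    refine (ContinuousLinearMap.le_opNorm _ _).trans ?_
    rw [norm_tr]
    exact mul_le_mul (hP.noise_J _ hx) (hP.c_bound _ hx) (norm_nonneg _) hp.εJ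
  unfold infErr Params.EJc
  rw [h1]
  refine (norm_sub_le _ _).trans ?_
  have := norm_add_le (tr (Jk P R k) (ck P R k - P.c (R.x k)))
    (tr (Jk P R k - P.J (R.x k)) (P.c (R.x k)))
  linarith

lemma infErr_sq_le_add (k : ℕ) : infErr P R k ^ 2 ≤ ‖JTck P R k‖ ^ 2 + p.EJc1 := by
  have h1 := hR.infErr_le_add hp hP k
  have h2 := hR.norm_JTck_le hp hP k
  have h3 : infErr P R k ≤ p.κJ * p.κc := (hR.infErr_le hP k).trans
    (mul_le_mul_of_nonneg_left (hP.c_bound _ (hR.x_mem k)) hp.κJ.le)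
  have h4 := hp.EJc_nonneg
  have h5 : 0 ≤ infErr P R k := norm_nonneg _
  have h6 := norm_nonneg (JTck P R k)
  unfold Params.EJc1
  calc infErr P R k ^ 2 = ‖JTck P R k‖ ^ 2
        + (infErr P R k - ‖JTck P R k‖) * (‖JTck P R k‖ + infErr P R k) := by ring
    _ ≤ ‖JTck P R k‖ ^ 2 + p.EJc * (‖JTck P R k‖ + infErr P R k) := by
        gcongr
        linarith
    _ ≤ _ := by gcongr

omit hp in
lemma feasErr_le_add (k : ℕ) : feasErr P R k ≤ ‖ck P R k‖ + p.εc := by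
  have h := norm_sub_le (P.cbar (R.x k)) (P.cbar (R.x k) - P.c (R.x k))
  rw [sub_sub_cancel] at h
  exact h.trans (add_le_add le_rfl (hP.noise_c _ (hR.x_mem k)))

lemma norm_JTck_le_of_small {k : ℕ} (h : ‖ck P R k‖ ≤ p.εo) : ‖JTck P R k‖ ≤ p.KJ * p.εc :=
  (tr_ck_le (hR.norm_Jk_le hP k)).trans
    (mul_le_mul_of_nonneg_left (h.trans hp.εo.2) hp.KJ_pos.le)

/-- Combining `‖c‖ ≤ 2 εc` with `‖c‖ ≤ κc` in the product `‖c‖²` gives the bound `EJc1`, so the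
second entry of the maximum in `EJc2` is not required here. -/
lemma infErr_sq_le_of_small {k : ℕ} (h : ‖ck P R k‖ ≤ p.εo) : infErr P R k ^ 2 ≤ p.EJc1 := by
  have h1 := hR.infErr_le hP k
  have h2 := hR.feasErr_le_add hP k
  have h3 : feasErr P R k ≤ 2 * p.εc := by linarith [hp.εo.2]
  have h4 : feasErr P R k ≤ p.κc := hP.c_bound _ (hR.x_mem k)
  have hκJ := hp.κJ
  have hκc := hp.κc
  have hεc := hp.εc
  have hεJ := hp.εJ
  have h5 : 0 ≤ feasErr P R k := norm_nonneg _
  have h6 : 0 ≤ infErr P R k := norm_nonneg _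
  have h7 : p.κJ * p.εc ≤ p.EJc := by
    have : 0 ≤ p.εJ * p.εc + p.κc * p.εJ := by positivity
    unfold Params.EJc Params.KJ
    linarith
  have h8 : 2 * (p.κJ * p.κc) ≤ p.KJ * p.Kc + p.κJ * p.κc := by
    have : 0 ≤ p.κJ * p.εc + p.εJ * (p.κc + p.εc) := by positivity
    unfold Params.KJ Params.Kc
    linarith
  calc infErr P R k ^ 2 ≤ (p.κJ * feasErr P R k) ^ 2 := by gcongr
    _ = p.κJ ^ 2 * (feasErr P R k * feasErr P R k) := by ring
    _ ≤ p.κJ ^ 2 * (2 * p.εc * p.κc) := by gcongr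
    _ = p.κJ * p.εc * (2 * (p.κJ * p.κc)) := by ring
    _ ≤ p.EJc * (p.KJ * p.Kc + p.κJ * p.κc) := by
      have := hp.EJc_nonneg
      gcongr

omit hp hP in
-- A nonzero null vector of `J` is tested in both bounds on `H`. The inequality `κH ζ⁻¹ ≥ 1` later
-- allows the natural constants to be enlarged to `κ1`, `κ2` and `Estat`.
lemma ζ_le_κH (k : ℕ) : p.ζ ≤ p.κH := by
  obtain ⟨u, hu, hu0⟩ := Submodule.exists_mem_ne_zero_of_ne_bot (hR.ker_J k)
  have h1 := hR.H_curv k u (Or.inl hu)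
  have h2 : inner ℝ u (R.H k u) ≤ ‖u‖ * (p.κH * ‖u‖) :=
    (real_inner_le_norm _ _).trans
      (mul_le_mul_of_nonneg_left ((R.H k).le_of_opNorm_le (hR.H_bound k) u) (norm_nonneg _))
  have h3 : 0 < ‖u‖ ^ 2 := by
    have := norm_pos_iff.2 hu0
    positivity
  refine le_of_mul_le_mul_right ?_ h3
  linarith

/-- The stationarity error in terms of the computed tangential step, its residual and the
distance of the two normal steps. -/
lemma statErr_le {k q : ℕ} {Z : Vec q →ₗᵢ[ℝ] Vec n} (hZ : IsNullBasis (P.J (R.x k)) Z) :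
    statErr P R k Z ≤ p.κH * ‖R.ubar k‖ + ‖ρk P R k‖
      + (p.εg + p.κybarStar * p.εJ + p.κH * ‖R.v k - R.vbar k‖) := by
  have hx := hR.x_mem k
  have hκH := hp.κH
  have hεJ := hp.εJ
  have hKJ := hp.KJ_pos
  set a := gradient P.f (R.x k) + R.H k (R.v k) with ha
  set b := gk P R k + R.H k (R.vbar k) with hb
  set w := tr Z.toContinuousLinearMap a with hw
  set s := Z w with hs
  have hsn : ‖s‖ = ‖w‖ := Z.norm_map w
  have hsJ : P.J (R.x k) s = 0 := by
    have : s ∈ LinearMap.range Z.toLinearMap := ⟨w, rfl⟩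
    rw [hZ] at this
    exact this
  -- The stationarity error is realized by a single null vector: with `w = Zᵀ a` and `s = Z w`,
  -- `‖w‖² = ⟨s, a⟩`.
  have hin : inner ℝ s a = ‖w‖ ^ 2 := by
    have h1 : inner ℝ w w = inner ℝ (Z.toContinuousLinearMap w) a :=
      ContinuousLinearMap.adjoint_inner_right _ w a
    rw [← real_inner_self_eq_norm_sq, h1]
    rfl
  -- The vector `s` lies in the kernel of `J`, not of `J̄`. On the component `y` the noisy
  -- multiplier disappears and the dual residual applies; `z` is small because `J̄ z = (J̄ - J) s`.
  obtain ⟨y, z, hy, hz, hyz, hyn, -⟩ := exists_ker_add_orthogonal (Jk P R k) s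
  have hab : ‖a - b‖ ≤ p.εg + p.κH * ‖R.v k - R.vbar k‖ := by
    have h1 : a - b = -(P.gbar (R.x k) - gradient P.f (R.x k)) + R.H k (R.v k - R.vbar k) := by
      rw [ha, hb, gk, map_sub]
      abel
    rw [h1]
    refine (norm_add_le _ _).trans (add_le_add ?_ ((R.H k).le_of_opNorm_le (hR.H_bound k) _))
    rw [norm_neg]
    exact hP.noise_g _ hx
  have hyb : inner ℝ y b ≤ ‖s‖ * (‖ρk P R k‖ + p.κH * ‖R.ubar k‖) := by
    have h1 : inner ℝ y b = inner ℝ y (ρk P R k - R.H k (R.ubar k)) := by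
      have h2 : ρk P R k - R.H k (R.ubar k) = tr (Jk P R k) (R.ybar k) + b := by
        rw [ρk, hb]
        abel
      rw [h2, inner_add_right y (tr (Jk P R k) (R.ybar k)) b,
        ContinuousLinearMap.adjoint_inner_right, hy, inner_zero_left, zero_add]
    rw [h1]
    refine (real_inner_le_norm _ _).trans ?_
    gcongr
    exact (norm_sub_le _ _).trans (add_le_add le_rfl ((R.H k).le_of_opNorm_le (hR.H_bound k) _))
  -- The nonnegative summand `κubarStar` is added only to match the definition of `κybarStar`.
  have hbn : ‖b‖ ≤ p.κg + p.εg + p.κH * (p.κubarStar + p.σJc * p.KJ * p.Kc) := by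
    have h1 : 0 ≤ p.κubarStar := by
      have := hp.κg
      have := hp.εg
      have := hp.σJc
      have := hp.Kc_pos
      have := hp.ζ
      unfold Params.κubarStar
      positivity
    refine (norm_add_le _ _).trans (add_le_add (hP.norm_gbar_le hx) ?_)
    refine ((R.H k).le_of_opNorm_le (hR.H_bound k) _).trans ?_
    gcongr
    linarith [hR.norm_vbar_le hp hP k]
  have hzn : ‖z‖ ≤ p.KJ * (p.κσ ^ 2)⁻¹ * (p.εJ * ‖s‖) := by
    refine ((hR.sv_Jbar k).norm_le hp.κσ (hR.norm_Jk_le hP k) hz).trans ?_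
    have h1 : Jk P R k z = (P.Jbar (R.x k) - P.J (R.x k)) s := by
      rw [sub_apply, hsJ, sub_zero, hyz]
      change _ = Jk P R k (y + z)
      rw [map_add, hy, zero_add]
    have h2 : ‖Jk P R k z‖ ≤ p.εJ * ‖s‖ := by
      rw [h1]
      exact ContinuousLinearMap.le_of_opNorm_le _ (hP.noise_J _ hx) s
    have := hp.κσ
    exact mul_le_mul_of_nonneg_left h2 (by positivity)
  have hzb : inner ℝ z b ≤ ‖s‖ * (p.κybarStar * p.εJ) := by
    refine (real_inner_le_norm _ _).trans ?_
    have := hp.κσ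
    calc ‖z‖ * ‖b‖ ≤ p.KJ * (p.κσ ^ 2)⁻¹ * (p.εJ * ‖s‖)
          * (p.κg + p.εg + p.κH * (p.κubarStar + p.σJc * p.KJ * p.Kc)) := by gcongr
      _ = _ := by unfold Params.κybarStar; ring
  have hsab : inner ℝ s (a - b) ≤ ‖s‖ * (p.εg + p.κH * ‖R.v k - R.vbar k‖) :=
    (real_inner_le_norm _ _).trans (by gcongr)
  have hsplit : inner ℝ s a = inner ℝ s (a - b) + inner ℝ y b + inner ℝ z b := by
    have h1 : inner ℝ s b = inner ℝ y b + inner ℝ z b := by rw [hyz, inner_add_left]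
    rw [inner_sub_right, h1]
    ring
  have hfin : ‖w‖ * ‖w‖ ≤ ‖w‖ * (p.κH * ‖R.ubar k‖ + ‖ρk P R k‖
      + (p.εg + p.κybarStar * p.εJ + p.κH * ‖R.v k - R.vbar k‖)) := by
    rw [hsn] at hyb hzb hsab
    linarith
  change ‖w‖ ≤ _
  rcases (norm_nonneg w).eq_or_lt with h0 | h0
  · rw [← h0]
    have h1 : 0 ≤ p.κybarStar := by
      have h2 := (norm_nonneg b).trans hbn
      have := hp.κσ
      unfold Params.κybarStar
      positivity
    have := hp.εg
    positivity
  · exact le_of_mul_le_mul_left hfin h0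

/-- Bound for the squared stationarity error; `V` measures the length of the noisy normal step. -/
lemma statErr_sq_le {k q : ℕ} {Z : Vec q →ₗᵢ[ℝ] Vec n} (hZ : IsNullBasis (P.J (R.x k)) Z) {V : ℝ}
    (hV : ‖R.vbar k‖ ^ 2 ≤ p.σJc ^ 2 * V) :
    statErr P R k Z ^ 2 ≤ p.κH ^ 2 * (2 + p.κ1) * ‖R.ubar k‖ ^ 2
      + p.κH ^ 2 * p.κ1 * ‖JTck P R k‖ ^ 2 + p.κH ^ 2 * p.κ2 * (infErr P R k ^ 2 + V)
      + p.κH ^ 2 * (12 * (p.ζ ^ 2)⁻¹ * (p.εg ^ 2 + p.κybarStar ^ 2 * p.εJ ^ 2)) := by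
  have hζ := hp.ζ
  have hκH := hp.κH
  have hratio : 1 ≤ p.κH * p.ζ⁻¹ := by
    rw [← div_eq_mul_inv, one_le_div hζ]
    exact hR.ζ_le_κH k
  have hratio2 : 1 ≤ p.κH ^ 2 * (p.ζ ^ 2)⁻¹ := by
    rw [← inv_pow, ← mul_pow]
    exact one_le_pow₀ hratio
  have hκ1 : 4 * p.lamρr ^ 2 ≤ p.κH ^ 2 * p.κ1 := by
    have h1 : 1 ≤ (p.κH * (p.ζ⁻¹ + p.KJ * (p.κσ ^ 2)⁻¹)) ^ 2 := by
      apply one_le_pow₀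
      have : 0 ≤ p.κH * (p.KJ * (p.κσ ^ 2)⁻¹) := by
        have := hp.KJ_pos
        positivity
      linarith
    have h2 := mul_le_mul_of_nonneg_left h1 (by positivity : 0 ≤ 4 * p.lamρr ^ 2)
    unfold Params.κ1
    linarith
  have hρ : ‖ρk P R k‖ ^ 2 ≤ p.lamρr ^ 2 * (‖R.ubar k‖ ^ 2 + ‖JTck P R k‖ ^ 2) := by
    have h1 : ‖ρk P R k‖ ≤ p.lamρr * max ‖R.ubar k‖ ‖JTck P R k‖ :=
      ((le_max_left _ _).trans (hR.direction k).resid).trans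
        (mul_le_mul_of_nonneg_left (min_le_left _ _) hp.lamρr.1.le)
    have h2 : max ‖R.ubar k‖ ‖JTck P R k‖ ^ 2 ≤ ‖R.ubar k‖ ^ 2 + ‖JTck P R k‖ ^ 2 := by
      rcases max_cases ‖R.ubar k‖ ‖JTck P R k‖ with h | h <;> rw [h.1] <;>
        nlinarith [sq_nonneg ‖R.ubar k‖, sq_nonneg ‖JTck P R k‖]
    calc ‖ρk P R k‖ ^ 2 ≤ (p.lamρr * max ‖R.ubar k‖ ‖JTck P R k‖) ^ 2 := by gcongr
      _ = p.lamρr ^ 2 * max ‖R.ubar k‖ ‖JTck P R k‖ ^ 2 := by ring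
      _ ≤ _ := by gcongr
  have hvv : ‖R.v k - R.vbar k‖ ^ 2 ≤ 2 * p.σJc ^ 2 * (infErr P R k ^ 2 + V) := by
    have h1 : ‖R.v k - R.vbar k‖ ≤ ‖R.v k‖ + ‖R.vbar k‖ := norm_sub_le _ _
    have h2 : ‖R.v k‖ ^ 2 ≤ p.σJc ^ 2 * infErr P R k ^ 2 := by
      rw [← mul_pow]
      have := (hR.trueStep k).norm_le
      unfold infErr
      gcongr
    calc ‖R.v k - R.vbar k‖ ^ 2 ≤ (‖R.v k‖ + ‖R.vbar k‖) ^ 2 := by gcongr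
      _ ≤ 2 * ‖R.v k‖ ^ 2 + 2 * ‖R.vbar k‖ ^ 2 := by
        nlinarith [sq_nonneg (‖R.v k‖ - ‖R.vbar k‖)]
      _ ≤ _ := by linarith
  set N := p.εg ^ 2 + p.κybarStar ^ 2 * p.εJ ^ 2 with hN
  set W := infErr P R k ^ 2 + V with hW
  have hW0 : 0 ≤ W := by
    have : 0 ≤ p.σJc ^ 2 * V := (sq_nonneg _).trans hV
    have : 0 ≤ V := nonneg_of_mul_nonneg_right this (by have := hp.σJc; positivity)
    positivity
  have hN0 : 0 ≤ N := by positivity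
  have hst := hR.statErr_le hp hP hZ
  have hst0 : 0 ≤ statErr P R k Z := norm_nonneg _
  set e₁ := p.κH * ‖R.ubar k‖
  set e₂ := ‖ρk P R k‖
  set e₄ := p.κybarStar * p.εJ
  set e₅ := p.κH * ‖R.v k - R.vbar k‖
  -- Two uses of `(a + b)² ≤ 2 a² + 2 b²` and one three-term bound with factor `3` give the weights
  -- `2`, `4` and `12`.
  have h1 : statErr P R k Z ^ 2 ≤ 2 * e₁ ^ 2 + 4 * e₂ ^ 2 + 12 * (p.εg ^ 2 + e₄ ^ 2 + e₅ ^ 2) := by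
    calc statErr P R k Z ^ 2 ≤ (e₁ + e₂ + (p.εg + e₄ + e₅)) ^ 2 := by gcongr
      _ ≤ 2 * e₁ ^ 2 + 2 * (e₂ + (p.εg + e₄ + e₅)) ^ 2 := by
        nlinarith [sq_nonneg (e₁ - (e₂ + (p.εg + e₄ + e₅)))]
      _ ≤ 2 * e₁ ^ 2 + 2 * (2 * e₂ ^ 2 + 2 * (p.εg + e₄ + e₅) ^ 2) := by
        nlinarith [sq_nonneg (e₂ - (p.εg + e₄ + e₅))]
      _ ≤ _ := by
        nlinarith [sq_nonneg (p.εg - e₄), sq_nonneg (p.εg - e₅), sq_nonneg (e₄ - e₅)]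
  have h2 : e₁ ^ 2 = p.κH ^ 2 * ‖R.ubar k‖ ^ 2 := mul_pow _ _ _
  have h3 : p.εg ^ 2 + e₄ ^ 2 = N := by rw [hN, ← mul_pow]
  have h4 : 12 * N ≤ p.κH ^ 2 * (12 * (p.ζ ^ 2)⁻¹ * N) := by
    have := mul_le_mul_of_nonneg_right hratio2 hN0
    linarith
  have h5 : 12 * e₅ ^ 2 ≤ p.κH ^ 2 * p.κ2 * W := by
    have h6 : 12 * e₅ ^ 2 ≤ 24 * p.κH ^ 2 * p.σJc ^ 2 * W := by
      have := mul_le_mul_of_nonneg_left hvv (sq_nonneg p.κH)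
      have h7 : e₅ ^ 2 = p.κH ^ 2 * ‖R.v k - R.vbar k‖ ^ 2 := mul_pow _ _ _
      rw [h7]
      linarith
    have h8 := mul_le_mul_of_nonneg_right hratio2
      (by positivity : 0 ≤ 24 * p.κH ^ 2 * p.σJc ^ 2 * W)
    unfold Params.κ2
    linarith
  have h6 : 4 * e₂ ^ 2 ≤ p.κH ^ 2 * p.κ1 * (‖R.ubar k‖ ^ 2 + ‖JTck P R k‖ ^ 2) := by
    have := mul_le_mul_of_nonneg_right hκ1
      (by positivity : 0 ≤ ‖R.ubar k‖ ^ 2 + ‖JTck P R k‖ ^ 2)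
    linarith
  rw [h2] at h1
  linarith

lemma statErr_sq_le_of_large {k q : ℕ} {Z : Vec q →ₗᵢ[ℝ] Vec n}
    (hZ : IsNullBasis (P.J (R.x k)) Z) :
    statErr P R k Z ^ 2 ≤ p.κH ^ 2 * (2 + p.κ1) * ‖R.ubar k‖ ^ 2
      + p.κH ^ 2 * (p.κ1 + 2 * p.κ2) * ‖JTck P R k‖ ^ 2 + 2 * p.κH ^ 2 * p.κ2 * p.EJc2
      + p.Estat := by
  have h1 := hR.statErr_sq_le hp hP hZ (hR.norm_vbar_sq_le hp k)
  have h2 := (hR.infErr_sq_le_add hp hP k).trans (add_le_add le_rfl Params.EJc1_le_EJc2)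
  have hκ2 : 0 ≤ p.κH ^ 2 * p.κ2 := mul_nonneg (sq_nonneg _) p.κ2_nonneg
  have h3 := mul_le_mul_of_nonneg_left h2 hκ2
  have h4 : 0 ≤ p.κH ^ 2 * p.κ2 * p.EJc2 :=
    mul_nonneg hκ2 (hp.EJc1_nonneg.trans Params.EJc1_le_EJc2)
  have hκ1 := p.κ1_nonneg
  have h5 : 0 ≤ p.κH ^ 2 * (p.κ1 * p.KJ ^ 2 * p.εc ^ 2)
      + p.κH ^ 2 * (12 * (p.ζ ^ 2)⁻¹ * (p.κyStar ^ 2 * p.εJ ^ 2)) := by positivity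
  unfold Params.Estat
  linarith

lemma statErr_sq_le_of_small {k q : ℕ} {Z : Vec q →ₗᵢ[ℝ] Vec n}
    (hZ : IsNullBasis (P.J (R.x k)) Z) (h : ‖ck P R k‖ ≤ p.εo) :
    statErr P R k Z ^ 2 ≤ p.κH ^ 2 * (2 + p.κ1) * ‖R.ubar k‖ ^ 2
      + 2 * p.κH ^ 2 * p.κ2 * p.EJc2 + p.Estat := by
  have h1 := hR.statErr_sq_le hp hP hZ (V := 0) (by simp [((hR.direction k).small h).1])
  have h2 := (hR.infErr_sq_le_of_small hp hP h).trans Params.EJc1_le_EJc2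
  have hκ2 : 0 ≤ p.κH ^ 2 * p.κ2 := mul_nonneg (sq_nonneg _) p.κ2_nonneg
  have h3 := mul_le_mul_of_nonneg_left h2 hκ2
  have h4 : 0 ≤ p.κH ^ 2 * p.κ2 * p.EJc2 :=
    mul_nonneg hκ2 (hp.EJc1_nonneg.trans Params.EJc1_le_EJc2)
  have hκ1 := p.κ1_nonneg
  have h5 : 0 ≤ p.κH ^ 2 * (12 * (p.ζ ^ 2)⁻¹ * (p.κyStar ^ 2 * p.εJ ^ 2)) := by positivity
  -- Here `J̄ᵀc̄` is itself noise, which accounts for the first summand of `Estat`.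
  have h6 : p.κH ^ 2 * p.κ1 * ‖JTck P R k‖ ^ 2 ≤ p.κH ^ 2 * p.κ1 * (p.KJ * p.εc) ^ 2 := by
    have := hR.norm_JTck_le_of_small hp hP h
    gcongr
  unfold Params.Estat
  linarith

end Errors

/-! ### Complexity bounds -/

section Complexity

variable (hR : IsRun P p rule X R) (hp : p.Valid rule) (hP : Regular P p X)
include hR hp hP

/-- If an error is bounded by a multiple `κ` of the decrease and a noise term `N`, then it falls
below `ε` within `O(ε⁻²)` iterations. -/
lemma exists_le_of_sq_le {κ N σε ε : ℝ} (hκ : 0 < κ) (hσε : 1 < σε) (hε : 0 < ε)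
    (hN : σε * (κ * p.Emerit rule + N) < ε ^ 2) {Q : ℕ → Prop}
    (hQ : ∀ k, ¬ Q k → ε ^ 2 ≤ κ * (p.η * R.α k * Δk P R k) + N) :
    ∃ k ≤ ⌈κ * gap P p R / ((1 - σε⁻¹) * ε ^ 2)⌉₊, Q k := by
  have hσ0 : 0 < σε := one_pos.trans hσε
  have h1 : 0 < 1 - σε⁻¹ := sub_pos.2 (inv_lt_one_of_one_lt₀ hσε)
  have h2 : κ * gap P p R / ((1 - σε⁻¹) * ε ^ 2) = gap P p R / ((1 - σε⁻¹) * ε ^ 2 / κ) := by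
    rw [div_div_eq_mul_div, mul_comm]
  rw [h2]
  -- The gain is `δ = (1 - σε⁻¹) ε² / κ`: the condition on `ε` lets the noise use up only the
  -- fraction `σε⁻¹` of `ε²`.
  refine hR.exists_le_ceil hp hP (by positivity) fun k hk => ?_
  have h3 := hQ k hk
  have h4 : κ * p.Emerit rule + N < σε⁻¹ * ε ^ 2 := by
    rw [inv_mul_eq_div, lt_div_iff₀ hσ0, mul_comm]
    exact hN
  rw [div_le_iff₀ hκ]
  linarith

/-- Common core of the bounds with and without control of `τ`: the lower bound `α` on the step size
is required only at iterates where the error exceeds `ε`. -/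
lemma exists_infErr_le {α N σε ε : ℝ} (hα : 0 < α) (hσε : 1 < σε) (hε : 0 < ε)
    (hN1 : p.EJc1 ≤ N)
    (hN : σε * (N + p.Kc / (p.η * α * p.σc * p.σv) * p.Emerit rule) < ε ^ 2)
    (hbig : ∀ k, ε < infErr P R k → p.εo < ‖ck P R k‖ ∧ α ≤ R.α k) :
    ∃ k ≤ ⌈p.Kc * gap P p R / (p.η * α * p.σc * p.σv * (1 - σε⁻¹) * ε ^ 2)⌉₊,
      infErr P R k ≤ ε := by
  have hpc := hp.common
  have hη := hpc.η.1
  have hσc := hpc.σc.1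
  have hσv := hpc.σv_pos
  have hKc := hpc.Kc_pos
  have key := hR.exists_le_of_sq_le hp hP (κ := p.Kc / (p.η * α * p.σc * p.σv)) (N := N)
    (Q := fun k => infErr P R k ≤ ε) (by positivity) hσε hε (by rwa [add_comm]) (fun k hk => by
      rw [not_le] at hk
      obtain ⟨hl, hαk⟩ := hbig k hk
      have h1 : infErr P R k ^ 2 ≤ _ := hR.infErr_sq_le_add hpc hP k
      have h2 : ε ^ 2 ≤ infErr P R k ^ 2 := by gcongr
      have h3 := hR.le_Δk_of_large' hpc hP hl
      have h4 : p.σc * p.σv / p.Kc * ‖JTck P R k‖ ^ 2 ≤ Δk P R k := by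
        have : 0 ≤ R.τ k * p.σu * p.lamu * ‖R.ubar k‖ ^ 2 := by
          have := hR.τ_pos hpc k
          have := hpc.σu.1
          have := hpc.lamu.1
          positivity
        linarith
      have h5 : ‖JTck P R k‖ ^ 2
          ≤ p.Kc / (p.η * α * p.σc * p.σv) * (p.η * R.α k * Δk P R k) := by
        calc ‖JTck P R k‖ ^ 2 = p.Kc / (p.η * α * p.σc * p.σv)
              * (p.η * α * (p.σc * p.σv / p.Kc * ‖JTck P R k‖ ^ 2)) := by field_simp
          _ ≤ _ := by
            have := hα.trans_le hαk
            gcongr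
      linarith)
  have e : p.Kc * gap P p R / (p.η * α * p.σc * p.σv * (1 - σε⁻¹) * ε ^ 2)
      = p.Kc / (p.η * α * p.σc * p.σv) * gap P p R / ((1 - σε⁻¹) * ε ^ 2) := by
    rw [div_mul_eq_mul_div, div_div]
    congr 1
    ring
  rwa [e]

omit hP in
lemma κσ_mul_feasErr_le (hsv : ∀ k, SingularValuesGE p.κσ (P.J (R.x k))) (k : ℕ) :
    p.κσ * feasErr P R k ≤ infErr P R k :=
  (hsv k).mul_norm_le_norm_tr hp.common.κσ (hR.ker_J k) _

/-- By `κσ ‖c‖ ≤ ‖Jᵀc‖`, this is the previous bound for the tolerance `κσ ε`. -/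
lemma exists_feasErr_le (hsv : ∀ k, SingularValuesGE p.κσ (P.J (R.x k))) {α N σε ε : ℝ}
    (hα : 0 < α) (hσε : 1 < σε) (hε : 0 < ε) (hN1 : p.EJc1 ≤ N)
    (hN : σε * (N / p.κσ ^ 2 + p.Kc / (p.η * α * p.σc * p.σv * p.κσ ^ 2) * p.Emerit rule)
      < ε ^ 2)
    (hbig : ∀ k, p.κσ * ε < infErr P R k → p.εo < ‖ck P R k‖ ∧ α ≤ R.α k) :
    ∃ k ≤ ⌈p.Kc * gap P p R / (p.η * α * p.σc * p.σv * p.κσ ^ 2 * (1 - σε⁻¹) * ε ^ 2)⌉₊,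
      feasErr P R k ≤ ε := by
  have hκσ := hp.common.κσ
  obtain ⟨k, hk, hle⟩ := hR.exists_infErr_le hp hP hα hσε (mul_pos hκσ hε) hN1 (by
    have h1 := mul_lt_mul_of_pos_left hN (by positivity : 0 < p.κσ ^ 2)
    rw [mul_pow]
    refine lt_of_eq_of_lt ?_ h1
    rw [div_mul_eq_div_div]
    field_simp) hbig
  refine ⟨k, hk.trans (le_of_eq ?_),
    le_of_mul_le_mul_left ((hR.κσ_mul_feasErr_le hp hsv k).trans hle) hκσ⟩
  congr 2
  ring

/-- From `ε > 2 γ` and `EJc ≤ γ` one gets `‖J̄ᵀc̄‖ > γ ≥ KJ εc`, which is impossible when `‖c̄‖ ≤ εo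
≤ εc`. -/
lemma large_of_infErr {γ ε : ℝ} (hγ : 0 < γ) (hEγ : p.EJc ≤ γ) (hε : 0 < ε)
    (hγε : 4 * γ ^ 2 < ε ^ 2) (k : ℕ) (h : ε < infErr P R k) :
    p.εo < ‖ck P R k‖ ∧ p.αlow0 γ rule ≤ R.α k := by
  have h1 := hR.infErr_le_add hp.common hP k
  have h2 : 2 * γ < ε := by
    refine lt_of_pow_lt_pow_left₀ 2 hε.le ?_
    linarith
  have h3 : γ < ‖JTck P R k‖ := by linarith
  have h4 : p.εo < ‖ck P R k‖ := by
    by_contra! hc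
    have h5 := hR.norm_JTck_le_of_small hp.common hP hc
    have h6 := mul_nonneg hp.common.κc.le hp.common.εJ
    unfold Params.EJc at hEγ
    linarith
  exact ⟨h4, hR.αlow0_le hp hP hγ h4 h3.le⟩

lemma large_of_infErr_of_τ_ge {τmin ε : ℝ} (hτmin : 0 < τmin) (hτ : ∀ k, τmin ≤ R.τ k)
    (hε : 0 < ε) (hN : p.EJc2 ≤ ε ^ 2) (k : ℕ) (h : ε < infErr P R k) :
    p.εo < ‖ck P R k‖ ∧ p.αlow τmin rule ≤ R.α k := by
  refine ⟨?_, hR.αlow_le hp hP hτmin hτ k⟩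
  by_contra! hc
  have h1 := (hR.infErr_sq_le_of_small hp.common hP hc).trans Params.EJc1_le_EJc2
  have h2 : ε ^ 2 < infErr P R k ^ 2 := by gcongr
  linarith

/-- The coefficient of `b` is not needed here; it is included so that both kinds of iterates share
one factor. -/
lemma weighted_le_of_small {τmin C b : ℝ} (hτmin : 0 < τmin) (hτ : ∀ k, τmin ≤ R.τ k) (hC : 0 ≤ C)
    (hb : 0 ≤ b) (k : ℕ) :
    C * ‖R.ubar k‖ ^ 2
      ≤ (2 * C / (τmin * p.σu * p.lamu * p.η * p.αlow τmin rule)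
        + b / (p.σc * p.η * p.αlow τmin rule)) * (p.η * R.α k * Δk P R k) := by
  have hpc := hp.common
  have hη := hpc.η.1
  have hσc := hpc.σc.1
  have hσu := hpc.σu.1
  have hlamu := hpc.lamu.1
  have hα := hp.αlow_pos hτmin
  have hαk := hR.αlow_le hp hP hτmin hτ k
  have hΔ := hR.Δk_pos hpc hP k
  have h1 : τmin * p.σu * p.lamu * ‖R.ubar k‖ ^ 2 ≤ 2 * Δk P R k := by
    refine le_trans ?_ (hR.le_two_Δk hpc hP k)
    have := hτ k
    gcongr
  have hαk' := hα.trans_le hαk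
  calc C * ‖R.ubar k‖ ^ 2 = 2 * C / (τmin * p.σu * p.lamu * p.η * p.αlow τmin rule)
        * (p.η * p.αlow τmin rule * (τmin * p.σu * p.lamu * ‖R.ubar k‖ ^ 2 / 2)) := by
        field_simp
    _ ≤ 2 * C / (τmin * p.σu * p.lamu * p.η * p.αlow τmin rule)
        * (p.η * R.α k * Δk P R k) := by
        gcongr
        linarith
    _ ≤ _ := by
        gcongr
        exact le_add_of_nonneg_right (by positivity)

/-- Each summand on the left is compared with the whole of `Δ`. The factor `2` of the first
coefficient is needed only for small `‖c̄‖`. -/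
lemma weighted_le_of_large {τmin C b : ℝ} (hτmin : 0 < τmin) (hτ : ∀ k, τmin ≤ R.τ k) (hC : 0 ≤ C)
    (hb : 0 ≤ b) {k : ℕ} (h : p.εo < ‖ck P R k‖) :
    C * ‖R.ubar k‖ ^ 2 + b * normalRed P R k
      ≤ (2 * C / (τmin * p.σu * p.lamu * p.η * p.αlow τmin rule)
        + b / (p.σc * p.η * p.αlow τmin rule)) * (p.η * R.α k * Δk P R k) := by
  have hpc := hp.common
  have hη := hpc.η.1
  have hσc := hpc.σc.1
  have hσu := hpc.σu.1
  have hlamu := hpc.lamu.1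
  have hα := hp.αlow_pos hτmin
  have hαk := hR.αlow_le hp hP hτmin hτ k
  have hΔ := hR.Δk_pos hpc hP k
  have hred := (hR.direction k).normalRed_pos hpc h (hR.norm_Jk_le hP k)
  have hτk := hR.τ_pos hpc k
  have h0 := hR.le_Δk_of_large hpc h
  have h1 : τmin * p.σu * p.lamu * ‖R.ubar k‖ ^ 2 ≤ Δk P R k := by
    have h2 : τmin * p.σu * p.lamu * ‖R.ubar k‖ ^ 2
        ≤ R.τ k * p.σu * p.lamu * ‖R.ubar k‖ ^ 2 := by
      have := hτ k
      gcongr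
    have := mul_pos hσc hred
    linarith
  have h2 : p.σc * normalRed P R k ≤ Δk P R k := by
    have : 0 ≤ R.τ k * p.σu * p.lamu * ‖R.ubar k‖ ^ 2 := by positivity
    linarith
  have hαk' := hα.trans_le hαk
  rw [add_mul]
  refine add_le_add ?_ ?_
  · calc C * ‖R.ubar k‖ ^ 2 = 2 * C / (τmin * p.σu * p.lamu * p.η * p.αlow τmin rule)
          * (p.η * p.αlow τmin rule * (τmin * p.σu * p.lamu * ‖R.ubar k‖ ^ 2 / 2)) := by
          field_simp
      _ ≤ _ := by
          gcongr
          linarith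
  · calc b * normalRed P R k = b / (p.σc * p.η * p.αlow τmin rule)
          * (p.η * p.αlow τmin rule * (p.σc * normalRed P R k)) := by field_simp
      _ ≤ _ := by gcongr

/-- Complexity bound for stationarity combined with another error measure `e`, which is bounded by
a multiple of the decrease along the normal step when the noisy constraint violation is large. -/
lemma exists_statErr_le {τmin b N κ σε ε : ℝ} (hτmin : 0 < τmin) (hτ : ∀ k, τmin ≤ R.τ k)
    (hσε : 1 < σε) (hε : 0 < ε) {q : ℕ → ℕ} {Z : ∀ k, Vec (q k) →ₗᵢ[ℝ] Vec n}
    (hZ : ∀ k, IsNullBasis (P.J (R.x k)) (Z k)) {e : ℕ → ℝ} (hb : 0 ≤ b)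
    (hsmall : ∀ k, ‖ck P R k‖ ≤ p.εo → e k ^ 2 ≤ N)
    (hlarge : ∀ k, p.εo < ‖ck P R k‖ → e k ^ 2 ≤ b * normalRed P R k + N)
    (hκ : κ = p.κH ^ 2 * (4 + 2 * p.κ1) / (τmin * p.σu * p.lamu * p.η * p.αlow τmin rule)
      + (p.κH ^ 2 * (p.κ1 + 2 * p.κ2) * p.Kc / p.σv + b) / (p.σc * p.η * p.αlow τmin rule))
    (hN : σε * (κ * p.Emerit rule + (2 * p.κH ^ 2 * p.κ2 * p.EJc2 + N + p.Estat)) < ε ^ 2) :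
    ∃ k ≤ ⌈κ * gap P p R / ((1 - σε⁻¹) * ε ^ 2)⌉₊, statErr P R k (Z k) ≤ ε ∧ e k ≤ ε := by
  have hpc := hp.common
  have hη := hpc.η.1
  have hσc := hpc.σc.1
  have hσu := hpc.σu.1
  have hlamu := hpc.lamu.1
  have hσv := hpc.σv_pos
  have hKc := hpc.Kc_pos
  have hκH := hpc.κH
  have hκ1 := p.κ1_nonneg
  have hκ2 := p.κ2_nonneg
  have hα := hp.αlow_pos hτmin
  have hκ' : κ = 2 * (p.κH ^ 2 * (2 + p.κ1)) / (τmin * p.σu * p.lamu * p.η * p.αlow τmin rule)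
      + (p.κH ^ 2 * (p.κ1 + 2 * p.κ2) * p.Kc / p.σv + b) / (p.σc * p.η * p.αlow τmin rule) := by
    rw [hκ]
    ring
  refine hR.exists_le_of_sq_le hp hP (by rw [hκ]; positivity) hσε hε hN fun k hk => ?_
  -- If the two errors are not both at most `ε`, their squares add up to at least `ε²`, so one
  -- inequality for the sum treats them simultaneously.
  have hsum : ε ^ 2 ≤ statErr P R k (Z k) ^ 2 + e k ^ 2 := by
    have h0 : 0 ≤ statErr P R k (Z k) := norm_nonneg _
    rw [not_and_or, not_le, not_le] at hk
    rcases hk with hk | hk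
    · have : ε ^ 2 ≤ statErr P R k (Z k) ^ 2 := by gcongr
      linarith [sq_nonneg (e k)]
    · have : ε ^ 2 ≤ e k ^ 2 := by gcongr
      linarith [sq_nonneg (statErr P R k (Z k))]
  rcases le_or_gt ‖ck P R k‖ p.εo with h | h
  · have h1 := hR.statErr_sq_le_of_small hpc hP (hZ k) h
    have h2 := hR.weighted_le_of_small hp hP hτmin hτ
      (by positivity : 0 ≤ p.κH ^ 2 * (2 + p.κ1))
      (by positivity : 0 ≤ p.κH ^ 2 * (p.κ1 + 2 * p.κ2) * p.Kc / p.σv + b) k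
    rw [← hκ'] at h2
    linarith [hsmall k h]
  · have h1 := hR.statErr_sq_le_of_large hpc hP (hZ k)
    have h2 := hR.weighted_le_of_large hp hP hτmin hτ
      (by positivity : 0 ≤ p.κH ^ 2 * (2 + p.κ1))
      (by positivity : 0 ≤ p.κH ^ 2 * (p.κ1 + 2 * p.κ2) * p.Kc / p.σv + b) h
    rw [← hκ'] at h2
    have h3 := (hR.direction k).normalRed_ge' hpc h (hR.norm_Jk_le hP k) (hR.norm_ck_le hP k)
    have h4 : p.κH ^ 2 * (p.κ1 + 2 * p.κ2) * ‖JTck P R k‖ ^ 2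
        ≤ p.κH ^ 2 * (p.κ1 + 2 * p.κ2) * p.Kc / p.σv * normalRed P R k := by
      calc _ = p.κH ^ 2 * (p.κ1 + 2 * p.κ2) * p.Kc / p.σv
            * (p.σv * ‖JTck P R k‖ ^ 2 / p.Kc) := by field_simp
        _ ≤ _ := by gcongr
    linarith [hlarge k h]

lemma norm_JTck_sq_le_of_large {k : ℕ} (h : p.εo < ‖ck P R k‖) :
    ‖JTck P R k‖ ^ 2 ≤ p.Kc / p.σv * normalRed P R k := by
  have hpc := hp.common
  have h3 := (hR.direction k).normalRed_ge' hpc h (hR.norm_Jk_le hP k) (hR.norm_ck_le hP k)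
  have hσv := hpc.σv_pos
  have hKc := hpc.Kc_pos
  calc ‖JTck P R k‖ ^ 2 = p.Kc / p.σv * (p.σv * ‖JTck P R k‖ ^ 2 / p.Kc) := by field_simp
    _ ≤ _ := by gcongr

/-- In `σv κσ² ‖c̄‖² ≤ normalRed ‖c̄‖` one factor `‖c̄‖` cancels. The bound is linear in `‖c̄‖` and
free of `Kc`, hence the error measure `√‖c‖` and the form of `κsfbar`. -/
lemma norm_ck_le_of_large (hsv : ∀ k, SingularValuesGE p.κσ (P.Jbar (R.x k))) {k : ℕ}
    (h : p.εo < ‖ck P R k‖) : ‖ck P R k‖ ≤ 1 / (p.σv * p.κσ ^ 2) * normalRed P R k := by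
  have hpc := hp.common
  have hσv := hpc.σv_pos
  have hκσ := hpc.κσ
  have h1 := (hR.direction k).normalRed_ge hpc h (hR.norm_Jk_le hP k)
  have h2 : p.κσ * ‖ck P R k‖ ≤ ‖JTck P R k‖ :=
    (hsv k).mul_norm_le_norm_tr hκσ (hR.ker_Jbar k) _
  have h3 : 0 < ‖ck P R k‖ := hpc.εo.1.trans_lt h
  rw [one_div_mul_eq_div, le_div_iff₀ (by positivity)]
  refine le_of_mul_le_mul_right ?_ h3
  calc _ = p.σv * (p.κσ * ‖ck P R k‖) ^ 2 := by ring
    _ ≤ p.σv * ‖JTck P R k‖ ^ 2 := by gcongr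
    _ ≤ _ := h1

end Complexity

end IsRun

end NoisySQP

end

/-! ### Assembly of the seven bounds -/

theorem theorem3p22 {n m : ℕ} (rule : NoisySQP.StepRule) (p : NoisySQP.Params)
    (hp : p.Valid rule) (P : NoisySQP.NoisyProblem n m) (X : Set (NoisySQP.Vec n))
    (hP : NoisySQP.Regular P p X) (R : NoisySQP.Iterates n m)
    (hR : NoisySQP.IsRun P p rule X R)
    (q : ℕ → ℕ) (Z : ∀ k, NoisySQP.Vec (q k) →ₗᵢ[ℝ] NoisySQP.Vec n)
    (hZ : ∀ k, NoisySQP.IsNullBasis (P.J (R.x k)) (Z k))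
    (σε : ℝ) (hσε : 1 < σε) :
    -- infeasible stationarity and feasibility, for arbitrary behaviour of the merit parameters
    (∀ γ : ℝ, 0 < γ → p.EJc ≤ γ →
      (∀ ε : ℝ, 0 < ε →
        max (4 * γ ^ 2) (σε * (p.EJc1
            + p.Kc / (p.η * p.αlow0 γ rule * p.σc * p.σv) * p.Emerit rule)) < ε ^ 2 →
        ∃ k ≤ ⌈p.Kc * NoisySQP.gap P p R
            / (p.η * p.αlow0 γ rule * p.σc * p.σv * (1 - σε⁻¹) * ε ^ 2)⌉₊,
          NoisySQP.infErr P R k ≤ ε) ∧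
      ((∀ k, NoisySQP.SingularValuesGE p.κσ (P.J (R.x k))) →
        ∀ ε : ℝ, 0 < ε →
        max (4 * γ ^ 2 / p.κσ ^ 2) (σε * (p.EJc1 / p.κσ ^ 2
            + p.Kc / (p.η * p.αlow0 γ rule * p.σc * p.σv * p.κσ ^ 2) * p.Emerit rule)) < ε ^ 2 →
        ∃ k ≤ ⌈p.Kc * NoisySQP.gap P p R
            / (p.η * p.αlow0 γ rule * p.σc * p.σv * p.κσ ^ 2 * (1 - σε⁻¹) * ε ^ 2)⌉₊,
          NoisySQP.feasErr P R k ≤ ε)) ∧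
    -- all five bounds when the merit parameters stay away from zero
    (∀ τmin : ℝ, 0 < τmin → (∀ k, τmin ≤ R.τ k) →
      (∀ ε : ℝ, 0 < ε →
        σε * (p.EJc2 + p.Kc / (p.η * p.αlow τmin rule * p.σc * p.σv) * p.Emerit rule) < ε ^ 2 →
        ∃ k ≤ ⌈p.Kc * NoisySQP.gap P p R
            / (p.η * p.αlow τmin rule * p.σc * p.σv * (1 - σε⁻¹) * ε ^ 2)⌉₊,
          NoisySQP.infErr P R k ≤ ε) ∧
      ((∀ k, NoisySQP.SingularValuesGE p.κσ (P.J (R.x k))) →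
        ∀ ε : ℝ, 0 < ε →
        σε * (p.EJc2 / p.κσ ^ 2
            + p.Kc / (p.η * p.αlow τmin rule * p.σc * p.σv * p.κσ ^ 2) * p.Emerit rule) < ε ^ 2 →
        ∃ k ≤ ⌈p.Kc * NoisySQP.gap P p R
            / (p.η * p.αlow τmin rule * p.σc * p.σv * p.κσ ^ 2 * (1 - σε⁻¹) * ε ^ 2)⌉₊,
          NoisySQP.feasErr P R k ≤ ε) ∧
      (∀ ε : ℝ, 0 < ε →
        σε * (p.κsi τmin rule * p.Emerit rule + (2 * p.κH ^ 2 * p.κ2 + 1) * p.EJc2 + p.Estat)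
          < ε ^ 2 →
        ∃ k ≤ ⌈p.κsi τmin rule * NoisySQP.gap P p R / ((1 - σε⁻¹) * ε ^ 2)⌉₊,
          NoisySQP.statErr P R k (Z k) ≤ ε ∧ NoisySQP.infErr P R k ≤ ε) ∧
      ((∀ k, NoisySQP.SingularValuesGE p.κσ (P.J (R.x k))) →
        ∀ ε : ℝ, 0 < ε →
        σε * (p.κsf τmin rule * p.Emerit rule + (2 * p.κH ^ 2 * p.κ2 + (p.κσ ^ 2)⁻¹) * p.EJc2
          + p.Estat) < ε ^ 2 →
        ∃ k ≤ ⌈p.κsf τmin rule * NoisySQP.gap P p R / ((1 - σε⁻¹) * ε ^ 2)⌉₊,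
          NoisySQP.statErr P R k (Z k) ≤ ε ∧ NoisySQP.feasErr P R k ≤ ε) ∧
      ((∀ k, NoisySQP.SingularValuesGE p.κσ (P.Jbar (R.x k))) →
        ∀ ε : ℝ, 0 < ε →
        σε * (p.κsfbar τmin rule * p.Emerit rule + 2 * p.κH ^ 2 * p.κ2 * p.EJc2 + 2 * p.εc
          + p.Estat) < ε ^ 2 →
        ∃ k ≤ ⌈p.κsfbar τmin rule * NoisySQP.gap P p R / ((1 - σε⁻¹) * ε ^ 2)⌉₊,
          NoisySQP.statErr P R k (Z k) ≤ ε ∧ √(NoisySQP.feasErr P R k) ≤ ε)) := by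
  have hpc := hp.common
  have hη := hpc.η.1
  have hσc := hpc.σc.1
  have hσv := hpc.σv_pos
  have hKc := hpc.Kc_pos
  have hκσ := hpc.κσ
  have hκH := hpc.κH
  have hE := hp.Emerit_nonneg
  have hEJc2 : 0 ≤ p.EJc2 := hpc.EJc1_nonneg.trans NoisySQP.Params.EJc1_le_EJc2
  have hκ1 := p.κ1_nonneg
  have hκ2 := p.κ2_nonneg
  refine ⟨fun γ hγ hEγ => ⟨fun ε hε hcond => ?_, fun hsv ε hε hcond => ?_⟩,
    fun τmin hτmin hτ => ⟨fun ε hε hcond => ?_, fun hsv ε hε hcond => ?_, fun ε hε hcond => ?_,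
      fun hsv ε hε hcond => ?_, fun hsv ε hε hcond => ?_⟩⟩
  · obtain ⟨h1, h2⟩ := max_lt_iff.1 hcond
    exact hR.exists_infErr_le hp hP (hp.αlow0_pos hγ) hσε hε le_rfl h2
      (hR.large_of_infErr hp hP hγ hEγ hε h1)
  · obtain ⟨h1, h2⟩ := max_lt_iff.1 hcond
    rw [div_lt_iff₀ (by positivity), ← mul_pow, mul_comm ε] at h1
    exact hR.exists_feasErr_le hp hP hsv (hp.αlow0_pos hγ) hσε hε le_rfl h2
      (hR.large_of_infErr hp hP hγ hEγ (mul_pos hκσ hε) h1)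
  · have hα := hp.αlow_pos hτmin
    refine hR.exists_infErr_le hp hP hα hσε hε NoisySQP.Params.EJc1_le_EJc2 hcond
      (hR.large_of_infErr_of_τ_ge hp hP hτmin hτ hε ?_)
    have hX : 0 ≤ p.Kc / (p.η * p.αlow τmin rule * p.σc * p.σv) * p.Emerit rule := by positivity
    -- As `σε > 1` and the merit noise is nonnegative, the condition on `ε` gives `EJc2 ≤ ε²`.
    nlinarith
  · have hα := hp.αlow_pos hτmin
    refine hR.exists_feasErr_le hp hP hsv hα hσε hε NoisySQP.Params.EJc1_le_EJc2 hcond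
      (hR.large_of_infErr_of_τ_ge hp hP hτmin hτ (mul_pos hκσ hε) ?_)
    have hX : 0 ≤ p.Kc / (p.η * p.αlow τmin rule * p.σc * p.σv * p.κσ ^ 2) * p.Emerit rule := by
      positivity
    have hY : 0 ≤ p.EJc2 / p.κσ ^ 2 := by positivity
    have hle : p.EJc2 / p.κσ ^ 2 ≤ ε ^ 2 := by nlinarith
    rw [div_le_iff₀ (by positivity)] at hle
    rw [mul_pow]
    linarith
  · have hα := hp.αlow_pos hτmin
    -- `b` is the factor in `‖J̄ᵀc̄‖² ≤ (Kc / σv) normalRed`.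
    refine hR.exists_statErr_le hp hP hτmin hτ hσε hε hZ (b := p.Kc / p.σv) (N := p.EJc2)
      (by positivity) (fun k h => (hR.infErr_sq_le_of_small hpc hP h).trans
        NoisySQP.Params.EJc1_le_EJc2) (fun k h => ?_) ?_ ?_
    · exact (hR.infErr_sq_le_add hpc hP k).trans (add_le_add
        (hR.norm_JTck_sq_le_of_large hp hP h) NoisySQP.Params.EJc1_le_EJc2)
    · unfold NoisySQP.Params.κsi
      field_simp
    · refine lt_of_eq_of_lt ?_ hcond
      ring
  · have hα := hp.αlow_pos hτmin
    have hsq : ∀ k, NoisySQP.feasErr P R k ^ 2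
        ≤ (p.κσ ^ 2)⁻¹ * NoisySQP.infErr P R k ^ 2 := by
      intro k
      have h1 := hR.κσ_mul_feasErr_le hp hsv k
      have h2 : 0 ≤ NoisySQP.feasErr P R k := norm_nonneg _
      rw [inv_mul_eq_div, le_div_iff₀ (by positivity), mul_comm, ← mul_pow]
      gcongr
    refine hR.exists_statErr_le hp hP hτmin hτ hσε hε hZ (b := (p.κσ ^ 2)⁻¹ * (p.Kc / p.σv))
      (N := (p.κσ ^ 2)⁻¹ * p.EJc2) (by positivity) (fun k h => ?_) (fun k h => ?_) ?_ ?_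
    · refine (hsq k).trans (mul_le_mul_of_nonneg_left ?_ (by positivity))
      exact (hR.infErr_sq_le_of_small hpc hP h).trans NoisySQP.Params.EJc1_le_EJc2
    · rw [mul_assoc, ← mul_add]
      refine (hsq k).trans (mul_le_mul_of_nonneg_left ?_ (by positivity))
      exact (hR.infErr_sq_le_add hpc hP k).trans (add_le_add
        (hR.norm_JTck_sq_le_of_large hp hP h) NoisySQP.Params.EJc1_le_EJc2)
    · unfold NoisySQP.Params.κsf
      field_simp
    · refine lt_of_eq_of_lt ?_ hcond
      ring
  · have hα := hp.αlow_pos hτmin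
    have hεc := hpc.εc
    have hsq : ∀ k, √(NoisySQP.feasErr P R k) ^ 2 ≤ ‖NoisySQP.ck P R k‖ + p.εc := fun k => by
      rw [Real.sq_sqrt (by exact norm_nonneg _)]
      exact hR.feasErr_le_add hP k
    -- The squared error is `‖c‖ ≤ ‖c̄‖ + εc`. For small `‖c̄‖` the second `εc` in `N` comes from
    -- `εo ≤ εc`.
    refine hR.exists_statErr_le hp hP hτmin hτ hσε hε hZ (b := 1 / (p.σv * p.κσ ^ 2))
      (N := 2 * p.εc) (by positivity) (fun k h => ?_) (fun k h => ?_) ?_ ?_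
    · linarith [hsq k, hpc.εo.2]
    · linarith [hsq k, hR.norm_ck_le_of_large hp hP hsv h]
    · unfold NoisySQP.Params.κsfbar
      field_simp
    · refine lt_of_eq_of_lt ?_ hcond
      ring
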